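/- Theorem 2. Consider a memoryless channel with input $X=(X_1,\dots,X_{n_t})\in\mathbb C^{n_t}$, output $Y\in\mathbb C^{n_r}$, state $H\in\mathbb C^{n_r\times n_t}$ and receiver channel state information $V$ in a general measurable space. In each channel use the $X_i\sim\mathcal{CN}(0,P_i)$, $P_i>0$, are independent, $X$ is independent of $(H,V)$, and $V\leftrightarrow H\leftrightarrow(X,Y)$ is a Markov chain; different channel uses are i.i.d. The codebooks are i.i.d. $\mathcal{CN}(0,P_i)$, and the substreams are decoded successively: the $i$-th decoder knows $X^{i-1}=(X_1,\dots,X_{i-1})$ and minimizes over the messages $m$ the metric $$D_i(m)=\frac1N\sum_{n=1}^N\left|g_i(y_n,v_n,x_n^{i-1})-f_i(y_n,v_n,x_n^{i-1})\,x_{i,n}(m)\right|^2 .$$ The generalized mutual information (GMI) of the $i$-th substream for given $(g_i,f_i)$ is $$I^{(i)}=\sup_{\theta<0}\left\{\theta\,\mathbf E\left|g_i(Y,V,X^{i-1})-f_i(Y,V,X^{i-1})X_i\right|^2-\Lambda_i(\theta)\right\},\qquad \Lambda_i(\theta)=\lim_{N\to\infty}\frac1N\log\mathbf E\left[e^{N\theta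 D_i(m)}\,\middle|\,(Y,V,X^{i-1})^N\right]\ \text{a.s.},$$ where $m$ is any message that was not transmitted (so its codeword is independent of the conditioning variables), and $I^{(i)}=-\infty$ if $\mathbf E|g_i-f_iX_i|^2=\infty$. Consider only receivers of the form $$g_i(y,v,x^{i-1})=\beta_i(v)^*\Bigl(y-\sum_{j<i}\gamma_j(v)x_j\Bigr),\qquad f_i(y,v,x^{i-1})=f_i(v),$$ with measurable $\beta_i,\gamma_j:\mathcal V\to\mathbb C^{n_r}$ and $f_i:\mathcal V\to\mathbb C$. Put $$\gamma_i(v)=\frac{\mathbf E[X_i^*Y|v]}{P_i},\quad \tilde Y=Y-\sum_{j<i}\gamma_j(V)X_j,\quad \tilde\beta_i(v)=\mathbf E[\tilde Y\tilde Y^*|v]^{-1}\mathbf E[X_i^*Y|v],$$ $$\tilde f_i(v)=\frac{\mathbf E[X_i^*Y|v]^*\,\mathbf E[\tilde Y\tilde Y^*|v]^{-1}\,\mathbf E[X_i^*Y|v]}{P_i},\quad Q_i(v)=\frac1{P_i^2\tilde f_i(v)(1-\tilde f_i(v))},$$ and assume that, for almost every $v$, $Y$ has finite second moments given $V=v$ and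 the matrices $\mathbf E[\tilde Y\tilde Y^*|v]$ are invertible for all $i$. Then, for all receivers of this form, the almost sure limits $\Lambda_i(\theta)$ exist as extended real numbers, and the following holds. (a) For every $i$, the supremum of the GMI of the $i$-th substream over all these receivers is $$I^{(i)}_{\mathrm{lin}}=\mathbf E\left[\log\frac{P_i}{P_i-\mathbf E[X_i^*Y|V]^*\,\mathbf E[\tilde Y\tilde Y^*|V]^{-1}\,\mathbf E[X_i^*Y|V]}\right]\in[0,\infty]\qquad(\log(P_i/0)=\infty).$$ (b) If $\tilde f_i(V)<1$ almost surely (so that $Q_i$ is well defined wherever $\tilde f_i\neq0$), this supremum is attained by the above $\gamma_1,\dots,\gamma_{i-1}$ with $\beta_i=\sqrt{Q_i}\,\tilde\beta_i$ and $f_i=\sqrt{Q_i}\,\tilde f_i$, i.e. $g_i=\sqrt{Q_i(v)}\,\tilde\beta_i(v)^*\tilde y$ and $f_i=\sqrt{Q_i(v)}\,\tilde f_i(v)$; where $\tilde f_i(v)=0$, also $\tilde\beta_i(v)=0$ and both functions are understood to be $0$. (c) The supremum of the sum of the GMIs of all $n_t$ substreams, over all these receivers with $\gamma_1,\dots,\gamma_{n_t}$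 common to the substreams, is $I^{(1)}_{\mathrm{lin}}+\dots+I^{(n_t)}_{\mathrm{lin}}$. -/

import Mathlib

open MeasureTheory ProbabilityTheory Filter Topology Matrix
open scoped ENNReal

namespace SGNNDR

noncomputable section

/-- The circularly symmetric complex Gaussian law `CN(0, p)` on `ℂ`: real and imaginary parts are
independent and each is `N(0, p/2)`. -/
def complexGaussian (p : ℝ) : Measure ℂ :=
  ((gaussianReal 0 (p / 2).toNNReal).prod (gaussianReal 0 (p / 2).toNNReal)).map
    (fun z : ℝ × ℝ => (⟨z.1, z.2⟩ : ℂ))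

theorem measurable_mkComplex : Measurable (fun z : ℝ × ℝ => (⟨z.1, z.2⟩ : ℂ)) :=
  Complex.measurableEquivRealProd.symm.measurable

instance (p : ℝ) : IsProbabilityMeasure (complexGaussian p) :=
  Measure.isProbabilityMeasure_map measurable_mkComplex.aemeasurable

/-- A memoryless state-dependent MIMO channel with `nt` inputs, `nr` outputs and receiver channel
state information (CSI) in a general alphabet `𝒱`:
* `P i` is the power of the `i`-th substream,
* `stateLaw` is the joint law of the channel state `H` and the CSI `V`,
* `channel` is the conditional law of the output `Y` given the input `X` and the state `H`. -/
structure Model (nt nr : ℕ) (𝒱 : Type*) [MeasurableSpace 𝒱] where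
  P : Fin nt → ℝ
  P_pos : ∀ i, 0 < P i
  stateLaw : Measure ((Fin nr → Fin nt → ℂ) × 𝒱)
  isProb_stateLaw : IsProbabilityMeasure stateLaw
  channel : Kernel ((Fin nt → ℂ) × (Fin nr → Fin nt → ℂ)) (Fin nr → ℂ)
  isMarkov_channel : IsMarkovKernel channel

/-- The variables `((X, (H, V)), Y)` of one channel use. -/
abbrev Use (nt nr : ℕ) (𝒱 : Type*) : Type _ :=
  ((Fin nt → ℂ) × ((Fin nr → Fin nt → ℂ) × 𝒱)) × (Fin nr → ℂ)

namespace Use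

variable {nt nr : ℕ} {𝒱 : Type*}

/-- The channel input `X`. -/
def X (u : Use nt nr 𝒱) : Fin nt → ℂ := u.1.1

/-- The channel state `H`. -/
def H (u : Use nt nr 𝒱) : Fin nr → Fin nt → ℂ := u.1.2.1

/-- The receiver CSI `V`. -/
def V (u : Use nt nr 𝒱) : 𝒱 := u.1.2.2

/-- The channel output `Y`. -/
def Y (u : Use nt nr 𝒱) : Fin nr → ℂ := u.2

/-- The inputs `X^{i-1}` of the substreams that are decoded before substream `i`. -/
def Xprev (u : Use nt nr 𝒱) (i : Fin nt) : {j : Fin nt // j < i} → ℂ := fun j => u.X j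

end Use

namespace Model

variable {nt nr : ℕ} {𝒱 : Type*} [MeasurableSpace 𝒱] (C : Model nt nr 𝒱)

instance : IsProbabilityMeasure C.stateLaw := C.isProb_stateLaw

instance : IsMarkovKernel C.channel := C.isMarkov_channel

/-- The joint law of `((X, (H, V)), Y)` in one channel use: the substreams `X_i ∼ CN(0, P_i)` are
independent, `X` is independent of `(H, V)`, and `Y` is drawn from the channel given `(X, H)`
(so that `V ↔ H ↔ (X, Y)` is a Markov chain). -/
def law : Measure (Use nt nr 𝒱) :=
  ((Measure.pi fun i => complexGaussian (C.P i)).prod C.stateLaw) ⊗ₘ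
    C.channel.comap (fun p => (p.1, p.2.1)) (by fun_prop)

instance : IsProbabilityMeasure C.law := by
  unfold law; infer_instance

/-- The law of the channel uses over time: the channel is used independently at each time. -/
def blockLaw : Measure (ℕ → Use nt nr 𝒱) := Measure.infinitePi fun _ => C.law

/-- The law of the receiver CSI `V`. -/
def csiLaw : Measure 𝒱 := C.stateLaw.map Prod.snd

/-! ### The GMI of a receiver for substream `i` -/

/-- `N · D_i = ∑_{n < N} |g(y_n, v_n, x_n^{i-1}) - f(y_n, v_n, x_n^{i-1}) c_n|²`, where `D_i` is the
decoding metric of the codeword `c` for the processing function `g` and the scaling function `f`. -/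
def totalMetric (i : Fin nt)
    (g f : (Fin nr → ℂ) → 𝒱 → ({j : Fin nt // j < i} → ℂ) → ℂ)
    (N : ℕ) (s : ℕ → Use nt nr 𝒱) (c : Fin N → ℂ) : ℝ :=
  ∑ n : Fin N, ‖g (s n).Y (s n).V ((s n).Xprev i) - f (s n).Y (s n).V ((s n).Xprev i) * c n‖ ^ 2

/-- `Λ_{i,N}(N θ) = log E[exp(N θ D_i(m)) | y^N, v^N, (x^{i-1})^N]` for a message `m` that was not
transmitted: its codeword has i.i.d. `CN(0, P_i)` entries, independent of what is observed. -/
def blockLogMGF (i : Fin nt)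
    (g f : (Fin nr → ℂ) → 𝒱 → ({j : Fin nt // j < i} → ℂ) → ℂ)
    (θ : ℝ) (N : ℕ) (s : ℕ → Use nt nr 𝒱) : EReal :=
  ENNReal.log (∫⁻ c, ENNReal.ofReal (Real.exp (θ * totalMetric i g f N s c))
    ∂(Measure.pi fun _ : Fin N => complexGaussian (C.P i)))

/-- `Λ_i(θ)`, the almost sure limit of `Λ_{i,N}(N θ) / N` as `N → ∞`. It is written with `limsup`
and `essSup` so as to be defined in every case; that it is the almost sure limit for the receivers
considered is part of the theorem. -/
def limitLogMGF (i : Fin nt)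
    (g f : (Fin nr → ℂ) → 𝒱 → ({j : Fin nt // j < i} → ℂ) → ℂ) (θ : ℝ) : EReal :=
  essSup (fun s => limsup (fun N : ℕ => C.blockLogMGF i g f θ N s / (N : EReal)) atTop) C.blockLaw

/-- The limit `E[|g(Y, V, X^{i-1}) - f(Y, V, X^{i-1}) X_i|²]` of the metric of the transmitted
codeword. -/
def meanMetric (i : Fin nt)
    (g f : (Fin nr → ℂ) → 𝒱 → ({j : Fin nt // j < i} → ℂ) → ℂ) : ℝ≥0∞ :=
  ∫⁻ u, ‖g u.Y u.V (u.Xprev i) - f u.Y u.V (u.Xprev i) * u.X i‖ₑ ^ 2 ∂C.law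

/-- The GMI of substream `i` for the processing function `g` and the scaling function `f`:
`sup_{θ < 0} (θ E[|g - f X_i|²] - Λ_i(θ))`. It is `-∞` if `E[|g - f X_i|²] = ∞`. -/
def gmi (i : Fin nt)
    (g f : (Fin nr → ℂ) → 𝒱 → ({j : Fin nt // j < i} → ℂ) → ℂ) : EReal :=
  ⨆ (θ : ℝ) (_ : θ < 0), ((θ : EReal) * (C.meanMetric i g f : EReal) - C.limitLogMGF i g f θ)

/-- The linear processing function `g_i(y, v, x^{i-1}) = β(v)^* (y - ∑_{j < i} γ_j(v) x_j)`. -/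
def linProc (i : Fin nt) (γ : Fin nt → 𝒱 → Fin nr → ℂ) (β : 𝒱 → Fin nr → ℂ) :
    (Fin nr → ℂ) → 𝒱 → ({j : Fin nt // j < i} → ℂ) → ℂ :=
  fun y v x => star (β v) ⬝ᵥ (y - ∑ j : {j : Fin nt // j < i}, x j • γ j v)

/-- A scaling function that depends on the CSI only. -/
def csiScale (i : Fin nt) (f : 𝒱 → ℂ) :
    (Fin nr → ℂ) → 𝒱 → ({j : Fin nt // j < i} → ℂ) → ℂ :=
  fun _ v _ => f v

/-- The GMI of substream `i` for the linear processing function given by `γ` and `β` and the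
scaling function `f`. -/
def linGMI (i : Fin nt) (γ : Fin nt → 𝒱 → Fin nr → ℂ) (β : 𝒱 → Fin nr → ℂ) (f : 𝒱 → ℂ) : EReal :=
  C.gmi i (linProc i γ β) (csiScale i f)

/-! ### The optimal receiver -/

/-- The conditional law of `(X, Y)` given `V = v`. -/
def condLaw : Kernel 𝒱 ((Fin nt → ℂ) × (Fin nr → ℂ)) :=
  condDistrib (fun u : Use nt nr 𝒱 => (u.X, u.Y)) Use.V C.law

/-- `E[X_i^* Y | v]`. -/
def crossMean (i : Fin nt) (v : 𝒱) : Fin nr → ℂ :=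
  fun k => ∫ z, star (z.1 i) * z.2 k ∂C.condLaw v

/-- `γ_i(v) = E[X_i^* Y | v] / P_i`. -/
def optγ (i : Fin nt) (v : 𝒱) : Fin nr → ℂ := ((C.P i : ℂ))⁻¹ • C.crossMean i v

/-- `E[Ỹ Ỹ^* | v]` for `Ỹ = Y - ∑_{j < i} γ_j(V) X_j` with the above `γ`. -/
def residualCov (i : Fin nt) (v : 𝒱) : Matrix (Fin nr) (Fin nr) ℂ :=
  Matrix.of fun k l => ∫ z,
    (z.2 - ∑ j : {j : Fin nt // j < i}, z.1 j • C.optγ j v) k *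
      star ((z.2 - ∑ j : {j : Fin nt // j < i}, z.1 j • C.optγ j v) l) ∂C.condLaw v

/-- `E[X_i^* Y | v]^* E[Ỹ Ỹ^* | v]⁻¹ E[X_i^* Y | v]`, which is a real number as the matrix is
Hermitian. -/
def quadForm (i : Fin nt) (v : 𝒱) : ℝ :=
  (star (C.crossMean i v) ⬝ᵥ ((C.residualCov i v)⁻¹ *ᵥ C.crossMean i v)).re

/-- `β̃_i(v) = E[Ỹ Ỹ^* | v]⁻¹ E[X_i^* Y | v]`. -/
def βTilde (i : Fin nt) (v : 𝒱) : Fin nr → ℂ := (C.residualCov i v)⁻¹ *ᵥ C.crossMean i v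

/-- `f̃_i(v) = E[X_i^* Y | v]^* E[Ỹ Ỹ^* | v]⁻¹ E[X_i^* Y | v] / P_i`. -/
def fTilde (i : Fin nt) (v : 𝒱) : ℝ := C.quadForm i v / C.P i

/-- `Q_i(v) = 1 / (P_i² f̃_i(v) (1 - f̃_i(v)))`. (Where `f̃_i(v) = 0`, also `β̃_i(v) = 0`, and the
value of `Q_i(v)` is immaterial.) -/
def Q (i : Fin nt) (v : 𝒱) : ℝ := 1 / (C.P i ^ 2 * C.fTilde i v * (1 - C.fTilde i v))

/-- `β_i = √Q_i β̃_i`. -/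
def optβ (i : Fin nt) (v : 𝒱) : Fin nr → ℂ := (√(C.Q i v) : ℂ) • C.βTilde i v

/-- `f_i = √Q_i f̃_i`. -/
def optf (i : Fin nt) (v : 𝒱) : ℂ := ((√(C.Q i v) * C.fTilde i v : ℝ) : ℂ)

/-- `E[log (P_i / (P_i - E[X_i^* Y | V]^* E[Ỹ Ỹ^* | V]⁻¹ E[X_i^* Y | V]))]` with values in
`[0, ∞]`, where `log (P_i / 0) = ∞`. -/
def linRate (i : Fin nt) : ℝ≥0∞ :=
  ∫⁻ v, (ENNReal.log (ENNReal.ofReal (C.P i) /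
    ENNReal.ofReal (C.P i - C.quadForm i v))).toENNReal ∂C.csiLaw

end Model

end

end SGNNDR

/-! Put t = -θ > 0. The codeword of a wrong message has i.i.d. Gaussian entries, so the block moment
generating function factors into Gaussian integrals, each equal to exp(-`metricExponent`). The
strong law turns the GMI into the supremum over t > 0 of E[`metricExponent`] - t E|g - f X_i|²
(`gmi_eq`), and for linear receivers both expectations are averages over the CSI of conditional
ones.

For fixed v everything happens in L² of the conditional law. The inputs are orthogonal there with
‖X_j‖² = P_j, the processed output is a vector w, and u = β̃_i^* Ỹ satisfies ⟨u, w⟩ = ⟨X_i, w⟩ for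
every linear estimate w, whatever γ it uses (`exists_projection`). With q = ‖u‖², Cauchy–Schwarz,
log s ≤ s - 1 and one completed square bound the conditional exponent minus t times the conditional
metric by log(P_i/(P_i - q)) when q < P_i (`exponent_le_of_inner_eq`). This holds for each t and v
separately, hence after averaging.

The stated receiver gives equality at t = P_i; the factor √Q_i is what makes this one t optimal for
all v with q < P_i (`approxReceiver_bounds`). Where q = P_i, the input is recovered without error,
and a gain K → ∞ gives unbounded rate at zero metric. The optimal γ is the same for all substreams,
so the individual suprema are approached simultaneously. -/

namespace SGNNDR

/-! ### Exponential moments of the metric of a Gaussian symbol -/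

section GaussianIntegral

open scoped NNReal

theorem lintegral_exp_neg_sq_gaussianReal {v : ℝ≥0} (hv : v ≠ 0) {τ : ℝ} (hτ : 0 ≤ τ) (a : ℝ) :
    ∫⁻ x, ENNReal.ofReal (Real.exp (-τ * (a - x) ^ 2)) ∂gaussianReal 0 v =
      ENNReal.ofReal (Real.exp (-τ * a ^ 2 / (1 + 2 * τ * v)) * √((1 + 2 * τ * v)⁻¹)) := by
  have hv0 : (0 : ℝ) < v := by positivity
  have hd : 0 < 1 + 2 * τ * v := by positivity
  -- Completing the square turns density times exponential into a multiple of a Gaussian density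
  -- with inverse variance 1/w = 1/v + 2τ and mean 2τaw.
  set w : ℝ≥0 := ⟨v / (1 + 2 * τ * v), by positivity⟩ with hw
  have hwv : (w : ℝ) = v / (1 + 2 * τ * v) := rfl
  have hw0 : w ≠ 0 := by
    have : (0 : ℝ) < w := by rw [hwv]; positivity
    exact_mod_cast this.ne'
  rw [gaussianReal_of_var_ne_zero _ hv, lintegral_withDensity_eq_lintegral_mul _
    (measurable_gaussianPDF _ _) (by fun_prop)]
  have key : ∀ x : ℝ, (gaussianPDF 0 v * fun x => ENNReal.ofReal (Real.exp (-τ * (a - x) ^ 2))) x =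
      ENNReal.ofReal (Real.exp (-τ * a ^ 2 / (1 + 2 * τ * v)) * √((1 + 2 * τ * v)⁻¹)) *
        gaussianPDF (2 * τ * a * w) w x := by
    intro x
    simp only [Pi.mul_apply, gaussianPDF, gaussianPDFReal]
    rw [← ENNReal.ofReal_mul (by positivity), ← ENNReal.ofReal_mul (by positivity)]
    congr 1
    have h1 : (√(2 * Real.pi * v))⁻¹ = √((1 + 2 * τ * v)⁻¹) * (√(2 * Real.pi * w))⁻¹ := by
      rw [← Real.sqrt_inv, ← Real.sqrt_inv, ← Real.sqrt_mul (by positivity), hwv]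
      congr 1
      field_simp
    rw [h1]
    have h2 : Real.exp (-(x - 0) ^ 2 / (2 * v)) * Real.exp (-τ * (a - x) ^ 2) =
        Real.exp (-τ * a ^ 2 / (1 + 2 * τ * v)) *
          Real.exp (-(x - 2 * τ * a * w) ^ 2 / (2 * w)) := by
      rw [← Real.exp_add, ← Real.exp_add, hwv]
      congr 1
      field_simp
      ring
    linear_combination (√((1 + 2 * τ * v)⁻¹) * (√(2 * Real.pi * w))⁻¹) * h2
  simp_rw [key]
  rw [lintegral_const_mul _ (measurable_gaussianPDF _ _), lintegral_gaussianPDF_eq_one _ hw0,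
    mul_one]

/-- `-log E[exp(-t |g - f c|²)]` for `c ∼ CN(0, p)`. -/
noncomputable def metricExponent (t p : ℝ) (g f : ℂ) : ℝ :=
  t * ‖g‖ ^ 2 / (1 + t * p * ‖f‖ ^ 2) + Real.log (1 + t * p * ‖f‖ ^ 2)

theorem metricExponent_nonneg {t p : ℝ} (ht : 0 ≤ t) (hp : 0 ≤ p) (g f : ℂ) :
    0 ≤ metricExponent t p g f := by
  have : 0 ≤ t * p * ‖f‖ ^ 2 := by positivity
  exact add_nonneg (by positivity) (Real.log_nonneg (by linarith))

theorem lintegral_exp_neg_metric {t p : ℝ} (ht : 0 ≤ t) (hp : 0 < p) (g f : ℂ) :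
    ∫⁻ c, ENNReal.ofReal (Real.exp (-t * ‖g - f * c‖ ^ 2)) ∂complexGaussian p =
      ENNReal.ofReal (Real.exp (-metricExponent t p g f)) := by
  by_cases hf : f = 0
  · simp [hf, metricExponent]
  have hf' : 0 < ‖f‖ := norm_pos_iff.2 hf
  -- The metric becomes |f|²|a - c|², a sum over real and imaginary parts, so the integral is a
  -- product of two real ones.
  set a := g / f
  have hg : g = f * a := by simp only [a]; field_simp
  have hsplit : ∀ z : ℝ × ℝ, ENNReal.ofReal (Real.exp (-t * ‖g - f * (⟨z.1, z.2⟩ : ℂ)‖ ^ 2)) =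
      ENNReal.ofReal (Real.exp (-(t * ‖f‖ ^ 2) * (a.re - z.1) ^ 2)) *
        ENNReal.ofReal (Real.exp (-(t * ‖f‖ ^ 2) * (a.im - z.2) ^ 2)) := by
    intro z
    rw [← ENNReal.ofReal_mul (by positivity), ← Real.exp_add, hg, ← mul_sub, norm_mul, mul_pow,
      Complex.sq_norm (a - _), Complex.normSq_apply]
    simp only [Complex.sub_re, Complex.sub_im]
    congr 2
    ring
  have hv : (p / 2).toNNReal ≠ 0 := by simpa using hp
  have hvc : ((p / 2).toNNReal : ℝ) = p / 2 := Real.coe_toNNReal _ (by positivity)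
  have hτ : 0 ≤ t * ‖f‖ ^ 2 := by positivity
  rw [complexGaussian, lintegral_map (by fun_prop) measurable_mkComplex]
  simp_rw [hsplit]
  rw [lintegral_prod_mul
      (f := fun x => ENNReal.ofReal (Real.exp (-(t * ‖f‖ ^ 2) * (a.re - x) ^ 2)))
      (g := fun x => ENNReal.ofReal (Real.exp (-(t * ‖f‖ ^ 2) * (a.im - x) ^ 2)))
      (by fun_prop) (by fun_prop), lintegral_exp_neg_sq_gaussianReal hv hτ,
    lintegral_exp_neg_sq_gaussianReal hv hτ, ← ENNReal.ofReal_mul (by positivity), hvc]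
  congr 1
  have hd : 0 < 1 + t * p * ‖f‖ ^ 2 := by positivity
  have hd' : 1 + 2 * (t * ‖f‖ ^ 2) * (p / 2) = 1 + t * p * ‖f‖ ^ 2 := by ring
  rw [hd', metricExponent, neg_add, Real.exp_add, Real.exp_neg (Real.log _), Real.exp_log hd,
    mul_mul_mul_comm, ← Real.exp_add, Real.mul_self_sqrt (by positivity)]
  congr 2
  rw [hg, norm_mul, mul_pow, Complex.sq_norm a, Complex.normSq_apply]
  field_simp
  ring

end GaussianIntegral

/-! ### Second moments and independence of the Gaussian inputs -/

section GaussianMoments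

variable {p : ℝ}

theorem memLp_id_complexGaussian (p : ℝ) : MemLp (fun c : ℂ => c) 2 (complexGaussian p) := by
  rw [complexGaussian, memLp_map_measure_iff (by fun_prop) measurable_mkComplex.aemeasurable]
  have h1 : MemLp (fun z : ℝ × ℝ => z.1) 2 ((gaussianReal 0 (p / 2).toNNReal).prod
      (gaussianReal 0 (p / 2).toNNReal)) :=
    (memLp_id_gaussianReal 2).comp_measurePreserving measurePreserving_fst
  have h2 : MemLp (fun z : ℝ × ℝ => z.2) 2 ((gaussianReal 0 (p / 2).toNNReal).prod
      (gaussianReal 0 (p / 2).toNNReal)) :=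
    (memLp_id_gaussianReal 2).comp_measurePreserving measurePreserving_snd
  exact memLp_re_im_iff.1 ⟨h1, h2⟩

theorem integral_id_complexGaussian (p : ℝ) : ∫ c, c ∂complexGaussian p = 0 := by
  have hi : Integrable (fun c : ℂ => c) (complexGaussian p) :=
    (memLp_id_complexGaussian p).integrable (by norm_num)
  have hre : ∫ c : ℂ, c.re ∂complexGaussian p = 0 := by
    rw [complexGaussian, integral_map measurable_mkComplex.aemeasurable
      Complex.measurable_re.aestronglyMeasurable]
    rw [integral_fun_fst (fun x : ℝ => x)]
    simp
  have him : ∫ c : ℂ, c.im ∂complexGaussian p = 0 := by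
    rw [complexGaussian, integral_map measurable_mkComplex.aemeasurable
      Complex.measurable_im.aestronglyMeasurable]
    rw [integral_fun_snd (fun x : ℝ => x)]
    simp
  apply Complex.ext
  · exact (integral_re hi).symm.trans hre
  · exact (integral_im hi).symm.trans him

theorem integral_star_mul_self_complexGaussian (hp : 0 ≤ p) :
    ∫ c, star c * c ∂complexGaussian p = p := by
  have hsq : Integrable (fun x : ℝ => x * x) (gaussianReal 0 (p / 2).toNNReal) := by
    have := (memLp_id_gaussianReal (μ := 0) (v := (p / 2).toNNReal) 2).integrable_sq
    simpa [pow_two] using this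
  have hv : ∫ x, x * x ∂gaussianReal 0 (p / 2).toNNReal = p / 2 := by
    have := variance_id_gaussianReal (μ := 0) (v := (p / 2).toNNReal)
    rw [variance_of_integral_eq_zero aemeasurable_id (by simp)] at this
    simpa [pow_two, Real.coe_toNNReal _ (div_nonneg hp zero_le_two)] using this
  have : ∀ c : ℂ, star c * c = ((c.re * c.re + c.im * c.im : ℝ) : ℂ) := by
    intro c
    rw [← Complex.normSq_apply]
    exact Complex.normSq_eq_conj_mul_self.symm
  simp_rw [this]
  rw [integral_complex_ofReal, complexGaussian, integral_map measurable_mkComplex.aemeasurable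
    (by fun_prop)]
  simp only
  rw [integral_add (hsq.comp_fst _) (hsq.comp_snd _),
    integral_fun_fst (fun x : ℝ => x * x), integral_fun_snd (fun x : ℝ => x * x)]
  simp [hv]

variable {ι : Type*} [Fintype ι] (P : ι → ℝ)

theorem memLp_apply_pi_complexGaussian (i : ι) :
    MemLp (fun x : ι → ℂ => x i) 2 (Measure.pi fun i => complexGaussian (P i)) :=
  (memLp_id_complexGaussian (P i)).comp_measurePreserving
    (measurePreserving_eval (fun i => complexGaussian (P i)) i)

theorem integral_star_mul_pi_complexGaussian [DecidableEq ι] (hP : ∀ i, 0 ≤ P i) (i j : ι) :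
    ∫ x, star (x i) * x j ∂(Measure.pi fun i => complexGaussian (P i)) =
      if i = j then (P i : ℂ) else 0 := by
  split_ifs with h
  · subst h
    rw [← integral_star_mul_self_complexGaussian (hP i),
      ← (measurePreserving_eval (fun i => complexGaussian (P i)) i).map_eq,
      integral_map (measurable_pi_apply _).aemeasurable (by fun_prop)]
  · have hind : iIndepFun (fun (i : ι) (x : ι → ℂ) => x i)
        (Measure.pi fun i => complexGaussian (P i)) :=
      iIndepFun_pi (X := fun _ => id) fun _ => aemeasurable_id
    have hij := (hind.indepFun h).comp (φ := star) (ψ := id) (by fun_prop) measurable_id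
    have hj : ∫ x : ι → ℂ, x j ∂(Measure.pi fun i => complexGaussian (P i)) = 0 := by
      rw [← integral_id_complexGaussian (P j),
        ← (measurePreserving_eval (fun i => complexGaussian (P i)) j).map_eq,
        integral_map (measurable_pi_apply _).aemeasurable (by fun_prop)]
    have := hij.integral_fun_mul_eq_mul_integral
      (Measurable.aestronglyMeasurable (by fun_prop))
      (Measurable.aestronglyMeasurable (by fun_prop))
    simp only [Function.comp_apply, id_eq] at this
    rw [this, hj, mul_zero]

theorem lintegral_pi_prod {Ω : Type*} [MeasurableSpace Ω] (μ : Measure Ω)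
    [IsProbabilityMeasure μ] (F : ι → Ω → ℝ≥0∞) (hF : ∀ i, Measurable (F i)) :
    ∫⁻ x, ∏ i, F i (x i) ∂(Measure.pi fun _ => μ) = ∏ i, ∫⁻ c, F i c ∂μ := by
  have hind : iIndepFun (fun (i : ι) (x : ι → Ω) => F i (x i)) (Measure.pi fun _ => μ) :=
    iIndepFun_pi fun i => (hF i).aemeasurable
  rw [lintegral_prod_eq_prod_lintegral_of_indepFun _ _ hind
    fun i => (hF i).comp (measurable_pi_apply i)]
  refine Finset.prod_congr rfl fun i _ => ?_
  rw [← (measurePreserving_eval (fun _ : ι => μ) i).lintegral_comp (hF i)]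

end GaussianMoments
-- Strong law of large numbers on the product space
section StrongLaw

variable {Ω : Type*} [MeasurableSpace Ω] (μ : Measure Ω) [IsProbabilityMeasure μ]

theorem strong_law_infinitePi {F : Ω → ℝ} (hF : Measurable F) (hi : Integrable F μ) :
    ∀ᵐ s ∂(Measure.infinitePi fun _ : ℕ => μ),
      Tendsto (fun N : ℕ => (∑ n ∈ Finset.range N, F (s n)) / N) atTop (𝓝 (∫ u, F u ∂μ)) := by
  have hmp : ∀ n : ℕ, MeasurePreserving (fun s : ℕ → Ω => s n)
      (Measure.infinitePi fun _ : ℕ => μ) μ := fun n =>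
    measurePreserving_eval_infinitePi (fun _ : ℕ => μ) n
  have hind : iIndepFun (fun (n : ℕ) (s : ℕ → Ω) => F (s n))
      (Measure.infinitePi fun _ : ℕ => μ) :=
    iIndepFun_infinitePi (X := fun _ => F) fun _ => hF
  have hlaw : ∀ n : ℕ, (Measure.infinitePi fun _ : ℕ => μ).map (fun s : ℕ → Ω => F (s n)) =
      μ.map F := fun n => by
    conv_rhs => rw [← (hmp n).map_eq, Measure.map_map hF (measurable_pi_apply n)]
    rfl
  have h := strong_law_ae_real (fun (n : ℕ) (s : ℕ → Ω) => F (s n))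
    ((hmp 0).integrable_comp_of_integrable hi) (fun m n hmn => hind.indepFun hmn)
    fun n => ⟨(hF.comp (measurable_pi_apply n)).aemeasurable,
      (hF.comp (measurable_pi_apply 0)).aemeasurable, by rw [hlaw, hlaw]⟩
  have hint : ∫ s : ℕ → Ω, F (s 0) ∂(Measure.infinitePi fun _ : ℕ => μ) = ∫ u, F u ∂μ := by
    conv_rhs => rw [← (hmp 0).map_eq, integral_map (hmp 0).aemeasurable hF.aestronglyMeasurable]
  rwa [hint] at h

/-- The strong law of large numbers for nonnegative random variables whose mean may be infinite. -/
theorem strong_law_infinitePi_of_nonneg {F : Ω → ℝ} (hF : Measurable F) (h0 : ∀ u, 0 ≤ F u) :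
    ∀ᵐ s ∂(Measure.infinitePi fun _ : ℕ => μ),
      Tendsto (fun N : ℕ => (((∑ n ∈ Finset.range N, F (s n)) / N : ℝ) : EReal)) atTop
        (𝓝 ((∫⁻ u, ENNReal.ofReal (F u) ∂μ : ℝ≥0∞) : EReal)) := by
  have lift : ∀ G : Ω → ℝ, Integrable G μ → (∀ u, 0 ≤ G u) →
      ((∫ u, G u ∂μ : ℝ) : EReal) = ((∫⁻ u, ENNReal.ofReal (G u) ∂μ : ℝ≥0∞) : EReal) := by
    intro G hG hG0
    rw [← ofReal_integral_eq_lintegral_ofReal hG (ae_of_all _ hG0), EReal.coe_ennreal_ofReal,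
      max_eq_left (integral_nonneg hG0)]
  by_cases hfin : ∫⁻ u, ENNReal.ofReal (F u) ∂μ = ⊤
  -- With infinite mean, the truncations at k have finite means tending to ∞, and their averages
  -- bound those of `F` from below.
  · have hmin : ∀ k : ℕ, Measurable fun u => min (F u) k := fun k => hF.min measurable_const
    have hmin0 : ∀ (k : ℕ) (u : Ω), 0 ≤ min (F u) k := fun k u => le_min (h0 u) k.cast_nonneg
    have hint : ∀ k : ℕ, Integrable (fun u => min (F u) k) μ := fun k =>
      Integrable.of_bound (hmin k).aestronglyMeasurable k (ae_of_all _ fun u => by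
        rw [Real.norm_of_nonneg (hmin0 k u)]
        exact min_le_right _ _)
    have hsup : ⨆ k : ℕ, ∫⁻ u, ENNReal.ofReal (min (F u) k) ∂μ = ⊤ := by
      rw [← lintegral_iSup (fun k => (hmin k).ennreal_ofReal), ← hfin]
      · refine lintegral_congr fun u => le_antisymm
          (iSup_le fun k => ENNReal.ofReal_le_ofReal (min_le_left _ _)) ?_
        obtain ⟨k, hk⟩ := exists_nat_ge (F u)
        exact le_iSup_of_le k (by rw [min_eq_left hk])
      · intro k l hkl u
        exact ENNReal.ofReal_le_ofReal (min_le_min_left _ (by exact_mod_cast hkl))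
    have hae := ae_all_iff.2 fun k : ℕ => strong_law_infinitePi μ (hmin k) (hint k)
    filter_upwards [hae] with s hs
    rw [hfin, EReal.coe_ennreal_top, EReal.tendsto_nhds_top_iff_real]
    intro x
    obtain ⟨k, hk⟩ := iSup_eq_top.1 hsup (ENNReal.ofReal x) ENNReal.ofReal_lt_top
    have hk' : x < ∫ u, min (F u) k ∂μ := by
      rw [← ofReal_integral_eq_lintegral_ofReal (hint k) (ae_of_all _ (hmin0 k))] at hk
      exact (ENNReal.ofReal_lt_ofReal_iff'.1 hk).1
    filter_upwards [(hs k).eventually (lt_mem_nhds hk')] with N hN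
    rw [EReal.coe_lt_coe_iff]
    refine hN.trans_le ?_
    gcongr
    exact min_le_left _ _
  · have hint : Integrable F μ := by
      refine ⟨hF.aestronglyMeasurable, ?_⟩
      rw [hasFiniteIntegral_iff_ofReal (ae_of_all _ h0)]
      exact lt_top_iff_ne_top.2 hfin
    rw [← lift F hint h0]
    filter_upwards [strong_law_infinitePi μ hF hint] with s hs
    exact (continuous_coe_real_ereal.tendsto _).comp hs

end StrongLaw

/-! ### Single-letter form of the GMI -/

theorem _root_.Measurable.metricExponent {Ω : Type*} [MeasurableSpace Ω] {G F : Ω → ℂ}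
    (hG : Measurable G) (hF : Measurable F) {t p : ℝ} :
    Measurable fun u => SGNNDR.metricExponent t p (G u) (F u) := by
  unfold SGNNDR.metricExponent
  fun_prop

namespace Model

variable {nt nr : ℕ} {𝒱 : Type*} [MeasurableSpace 𝒱] (C : Model nt nr 𝒱) {i : Fin nt}
  {g f : (Fin nr → ℂ) → 𝒱 → ({j : Fin nt // j < i} → ℂ) → ℂ} {θ : ℝ}

theorem blockLogMGF_eq (hθ : θ ≤ 0) (N : ℕ) (s : ℕ → Use nt nr 𝒱) :
    C.blockLogMGF i g f θ N s = ((-∑ n ∈ Finset.range N, metricExponent (-θ) (C.P i)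
      (g (s n).Y (s n).V ((s n).Xprev i)) (f (s n).Y (s n).V ((s n).Xprev i)) : ℝ) : EReal) := by
  have hexp : ∀ c : Fin N → ℂ, ENNReal.ofReal (Real.exp (θ * totalMetric i g f N s c)) =
      ∏ n : Fin N, ENNReal.ofReal (Real.exp (-(-θ) * ‖g (s n).Y (s n).V ((s n).Xprev i) -
        f (s n).Y (s n).V ((s n).Xprev i) * c n‖ ^ 2)) := by
    intro c
    rw [totalMetric, Finset.mul_sum, Real.exp_sum,
      ENNReal.ofReal_prod_of_nonneg fun _ _ => (Real.exp_pos _).le]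
    simp only [neg_neg]
  rw [blockLogMGF]
  simp_rw [hexp]
  rw [lintegral_pi_prod (complexGaussian (C.P i)) (fun (n : Fin N) (c : ℂ) =>
    ENNReal.ofReal (Real.exp (-(-θ) * ‖g (s n).Y (s n).V ((s n).Xprev i) -
        f (s n).Y (s n).V ((s n).Xprev i) * c‖ ^ 2))) (fun n => by fun_prop)]
  simp_rw [lintegral_exp_neg_metric (neg_nonneg.2 hθ) (C.P_pos i)]
  rw [← ENNReal.ofReal_prod_of_nonneg fun _ _ => (Real.exp_pos _).le, ← Real.exp_sum,
    ENNReal.log_ofReal_of_pos (Real.exp_pos _), Real.log_exp, Finset.sum_neg_distrib,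
    Fin.sum_univ_eq_sum_range (fun n => metricExponent (-θ) (C.P i)
      (g (s n).Y (s n).V ((s n).Xprev i)) (f (s n).Y (s n).V ((s n).Xprev i)))]

theorem tendsto_blockLogMGF (hθ : θ ≤ 0)
    (hg : Measurable fun u : Use nt nr 𝒱 => g u.Y u.V (u.Xprev i))
    (hf : Measurable fun u : Use nt nr 𝒱 => f u.Y u.V (u.Xprev i)) :
    ∀ᵐ s ∂C.blockLaw, Tendsto (fun N : ℕ => C.blockLogMGF i g f θ N s / (N : EReal)) atTop
      (𝓝 (-((∫⁻ u, ENNReal.ofReal (metricExponent (-θ) (C.P i) (g u.Y u.V (u.Xprev i))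
        (f u.Y u.V (u.Xprev i))) ∂C.law : ℝ≥0∞) : EReal))) := by
  have hm : Measurable fun u : Use nt nr 𝒱 => metricExponent (-θ) (C.P i)
      (g u.Y u.V (u.Xprev i)) (f u.Y u.V (u.Xprev i)) := hg.metricExponent hf
  filter_upwards [strong_law_infinitePi_of_nonneg C.law hm fun u =>
    metricExponent_nonneg (neg_nonneg.2 hθ) (C.P_pos i).le _ _] with s hs
  refine ((continuous_neg.tendsto _).comp hs).congr fun N => ?_
  rw [blockLogMGF_eq C hθ, Function.comp_apply, ← EReal.coe_neg, ← neg_div, EReal.coe_div]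
  simp

/-- The almost sure limit is a constant, so the `limsup` and the `essSup` both reduce to it. -/
theorem limitLogMGF_eq (hθ : θ ≤ 0)
    (hg : Measurable fun u : Use nt nr 𝒱 => g u.Y u.V (u.Xprev i))
    (hf : Measurable fun u : Use nt nr 𝒱 => f u.Y u.V (u.Xprev i)) :
    C.limitLogMGF i g f θ = -((∫⁻ u, ENNReal.ofReal (metricExponent (-θ) (C.P i)
      (g u.Y u.V (u.Xprev i)) (f u.Y u.V (u.Xprev i))) ∂C.law : ℝ≥0∞) : EReal) := by
  have : IsProbabilityMeasure C.blockLaw := by unfold blockLaw; infer_instance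
  rw [limitLogMGF, essSup_congr_ae
    ((C.tendsto_blockLogMGF hθ hg hf).mono fun s hs => hs.limsup_eq)]
  exact essSup_const _ (IsProbabilityMeasure.ne_zero _)

/-- Both expectations are kept in `ℝ≥0∞`. If the mean metric is infinite, the first summand is `⊥`,
and `⊥ + ⊤ = ⊥` in `EReal` yields the convention that the GMI is -∞. -/
theorem gmi_eq (hg : Measurable fun u : Use nt nr 𝒱 => g u.Y u.V (u.Xprev i))
    (hf : Measurable fun u : Use nt nr 𝒱 => f u.Y u.V (u.Xprev i)) :
    C.gmi i g f = ⨆ (t : ℝ) (_ : 0 < t), (-((ENNReal.ofReal t * C.meanMetric i g f : ℝ≥0∞) : EReal)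
      + ((∫⁻ u, ENNReal.ofReal (metricExponent t (C.P i) (g u.Y u.V (u.Xprev i))
        (f u.Y u.V (u.Xprev i))) ∂C.law : ℝ≥0∞) : EReal)) := by
  have key : ∀ t : ℝ, 0 < t → ((-t : ℝ) : EReal) * (C.meanMetric i g f : EReal) -
      C.limitLogMGF i g f (-t) = -((ENNReal.ofReal t * C.meanMetric i g f : ℝ≥0∞) : EReal)
      + ((∫⁻ u, ENNReal.ofReal (metricExponent t (C.P i) (g u.Y u.V (u.Xprev i))
        (f u.Y u.V (u.Xprev i))) ∂C.law : ℝ≥0∞) : EReal) := by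
    intro t ht
    rw [C.limitLogMGF_eq (neg_nonpos.2 ht.le) hg hf, sub_eq_add_neg, neg_neg, neg_neg,
      EReal.coe_neg, EReal.neg_mul, EReal.coe_ennreal_mul, EReal.coe_ennreal_ofReal,
      max_eq_left ht.le]
  refine le_antisymm (iSup₂_le fun θ hθ => ?_) (iSup₂_le fun t ht => ?_)
  · refine le_iSup₂_of_le (-θ) (neg_pos.2 hθ) ?_
    rw [← key _ (neg_pos.2 hθ), neg_neg]
  · refine le_iSup₂_of_le (-t) (neg_lt_zero.2 ht) ?_
    rw [key t ht]

end Model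
-- Measurability of matrix operations
section Measurability

variable {α ι : Type*} [MeasurableSpace α] [Fintype ι]

theorem measurable_det_of_entries [DecidableEq ι] {A : α → Matrix ι ι ℂ}
    (hA : ∀ k l, Measurable fun a => A a k l) : Measurable fun a => (A a).det := by
  simp_rw [Matrix.det_apply]
  refine Finset.measurable_fun_sum _ fun σ _ => Measurable.const_smul ?_ _
  exact Finset.measurable_fun_prod _ fun k _ => hA _ _

/-- The entries of the adjugate are determinants. Since 0⁻¹ = 0, the formula det⁻¹ · adjugate also
covers singular matrices. -/
theorem measurable_inv_apply_of_entries [DecidableEq ι] {A : α → Matrix ι ι ℂ}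
    (hA : ∀ k l, Measurable fun a => A a k l) (k l : ι) :
    Measurable fun a => (A a)⁻¹ k l := by
  have hadj : Measurable fun a => (A a).adjugate k l := by
    simp_rw [Matrix.adjugate_apply]
    refine measurable_det_of_entries fun m n => ?_
    by_cases h : m = l
    · subst h; simp
    · simpa [Matrix.updateRow_apply, h] using hA m n
  simp only [Matrix.inv_def, Matrix.smul_apply, smul_eq_mul, Ring.inverse_eq_inv']
  exact (measurable_det_of_entries hA).inv.mul hadj

theorem measurable_mulVec_of_entries {A : α → Matrix ι ι ℂ} {b : α → ι → ℂ}
    (hA : ∀ k l, Measurable fun a => A a k l) (hb : Measurable b) :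
    Measurable fun a => A a *ᵥ b a := by
  refine measurable_pi_lambda _ fun k => ?_
  simp only [Matrix.mulVec, dotProduct]
  exact Finset.measurable_fun_sum _ fun l _ => (hA k l).mul ((measurable_pi_apply l).comp hb)

end Measurability

section Use

variable {nt nr : ℕ} {𝒱 : Type*} [MeasurableSpace 𝒱]

@[fun_prop] theorem Use.measurable_X : Measurable (Use.X : Use nt nr 𝒱 → _) :=
  measurable_fst.comp measurable_fst

@[fun_prop] theorem Use.measurable_V : Measurable (Use.V : Use nt nr 𝒱 → _) :=
  measurable_snd.comp (measurable_snd.comp measurable_fst)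

@[fun_prop] theorem Use.measurable_Y : Measurable (Use.Y : Use nt nr 𝒱 → _) := measurable_snd

end Use

/-! ### Disintegration of a channel use over the CSI -/

namespace Model

variable {nt nr : ℕ} {𝒱 : Type*} [MeasurableSpace 𝒱] (C : Model nt nr 𝒱)

instance : IsMarkovKernel C.condLaw := by unfold condLaw; infer_instance

instance : IsProbabilityMeasure C.csiLaw :=
  Measure.isProbabilityMeasure_map measurable_snd.aemeasurable

theorem law_map_fst : C.law.map Prod.fst =
    (Measure.pi fun i => complexGaussian (C.P i)).prod C.stateLaw :=
  Measure.fst_compProd _ _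

theorem law_map_V_X : C.law.map (fun u => (u.V, u.X)) =
    C.csiLaw.prod (Measure.pi fun i => complexGaussian (C.P i)) := by
  have h : (fun u : Use nt nr 𝒱 => (u.V, u.X)) =
      Prod.swap ∘ Prod.map id Prod.snd ∘ Prod.fst := rfl
  rw [h, ← Measure.map_map measurable_swap (by fun_prop), ← Measure.map_map (by fun_prop)
    measurable_fst, law_map_fst, ← Measure.map_prod_map _ _ measurable_id measurable_snd,
    Measure.map_id, Measure.prod_swap]
  rfl

theorem law_map_V : C.law.map Use.V = C.csiLaw := by
  have h : (Use.V : Use nt nr 𝒱 → 𝒱) = Prod.fst ∘ fun u => (u.V, u.X) := rfl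
  rw [h, ← Measure.map_map measurable_fst (by fun_prop), law_map_V_X]
  exact Measure.fst_prod

/-- X is independent of V, so the constant kernel is a version of the conditional law of X; such
versions agree almost everywhere. -/
theorem condLaw_map_fst : ∀ᵐ v ∂C.csiLaw, (C.condLaw v).map Prod.fst =
    Measure.pi fun i => complexGaussian (C.P i) := by
  have h1 := condDistrib_comp (mβ := ‹MeasurableSpace 𝒱›) (μ := C.law) (Y := fun u : Use nt nr 𝒱 => (u.X, u.Y)) Use.V
    (by fun_prop) (f := Prod.fst) measurable_fst
  have h2 := condDistrib_ae_eq_of_measure_eq_compProd (μ := C.law) (Y := Use.X) Use.V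
    (by fun_prop) (κ := Kernel.const 𝒱 (Measure.pi fun i => complexGaussian (C.P i)))
    (by rw [law_map_V_X, law_map_V, Measure.compProd_const])
  rw [law_map_V] at h1 h2
  filter_upwards [h1, h2] with v hv1 hv2
  rw [← Kernel.map_apply _ measurable_fst]
  exact hv1.symm.trans (hv2.trans (Kernel.const_apply _ _))

theorem lintegral_law {F : 𝒱 → (Fin nt → ℂ) × (Fin nr → ℂ) → ℝ≥0∞}
    (hF : Measurable (Function.uncurry F)) :
    ∫⁻ u, F u.V (u.X, u.Y) ∂C.law = ∫⁻ v, ∫⁻ z, F v z ∂C.condLaw v ∂C.csiLaw := by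
  have h := compProd_map_condDistrib (mβ := ‹MeasurableSpace 𝒱›) (μ := C.law) (X := Use.V)
    (Y := fun u : Use nt nr 𝒱 => (u.X, u.Y)) (by fun_prop)
  rw [law_map_V] at h
  refine Eq.trans ?_ (Measure.lintegral_compProd (μ := C.csiLaw) (κ := C.condLaw) hF)
  rw [condLaw, h, lintegral_map hF (by fun_prop)]
  rfl

theorem measurable_integral_condLaw {F : 𝒱 → (Fin nt → ℂ) × (Fin nr → ℂ) → ℂ}
    (hF : Measurable (Function.uncurry F)) :
    Measurable fun v => ∫ z, F v z ∂C.condLaw v :=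
  (hF.stronglyMeasurable.integral_kernel_prod_right' (κ := C.condLaw)).measurable

theorem measurable_crossMean (i : Fin nt) : Measurable (C.crossMean i) :=
  measurable_pi_lambda _ fun k => C.measurable_integral_condLaw
    (F := fun _ z => star (z.1 i) * z.2 k) (by unfold Function.uncurry; fun_prop)

theorem measurable_optγ (i : Fin nt) : Measurable (C.optγ i) := by
  have := C.measurable_crossMean i
  unfold optγ
  fun_prop

theorem measurable_residualCov (i : Fin nt) (k l : Fin nr) :
    Measurable fun v => C.residualCov i v k l := by
  have h (m : Fin nr) : Measurable fun p : 𝒱 × ((Fin nt → ℂ) × (Fin nr → ℂ)) =>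
      (p.2.2 - ∑ j : {j : Fin nt // j < i}, p.2.1 j • C.optγ j p.1) m := by
    simp only [Pi.sub_apply, Finset.sum_apply, Pi.smul_apply, smul_eq_mul]
    have := fun j => C.measurable_optγ j
    fun_prop
  exact C.measurable_integral_condLaw (F := fun v z =>
    (z.2 - ∑ j : {j : Fin nt // j < i}, z.1 j • C.optγ j v) k *
      star ((z.2 - ∑ j : {j : Fin nt // j < i}, z.1 j • C.optγ j v) l)) ((h k).mul (continuous_star.measurable.comp (h l)))

theorem measurable_βTilde (i : Fin nt) : Measurable (C.βTilde i) :=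
  measurable_mulVec_of_entries
    (measurable_inv_apply_of_entries fun k l => C.measurable_residualCov i k l)
    (C.measurable_crossMean i)

theorem measurable_quadForm (i : Fin nt) : Measurable (C.quadForm i) := by
  have h1 := C.measurable_βTilde i
  have h2 := C.measurable_crossMean i
  refine Complex.measurable_re.comp ?_
  change Measurable fun v => ∑ k, star (C.crossMean i v k) * C.βTilde i v k
  fun_prop

theorem measurable_fTilde (i : Fin nt) : Measurable (C.fTilde i) :=
  (C.measurable_quadForm i).div_const _

theorem measurable_Q (i : Fin nt) : Measurable (C.Q i) := by
  have := C.measurable_fTilde i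
  unfold Q
  fun_prop

theorem measurable_optβ (i : Fin nt) : Measurable (C.optβ i) := by
  have := C.measurable_Q i
  have := C.measurable_βTilde i
  unfold optβ
  fun_prop

theorem measurable_optf (i : Fin nt) : Measurable (C.optf i) := by
  have := C.measurable_Q i
  have := C.measurable_fTilde i
  unfold optf
  fun_prop

/-! ### The metric of linear receivers, conditionally on the CSI -/

variable (i : Fin nt) (γ : Fin nt → 𝒱 → Fin nr → ℂ) (β : 𝒱 → Fin nr → ℂ) (f : 𝒱 → ℂ)

theorem measurable_linProc {Ω : Type*} [MeasurableSpace Ω] {y : Ω → Fin nr → ℂ} {v : Ω → 𝒱}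
    {x : Ω → {j : Fin nt // j < i} → ℂ} {γ : Fin nt → 𝒱 → Fin nr → ℂ} {β : 𝒱 → Fin nr → ℂ}
    (hγ : ∀ j, Measurable (γ j)) (hβ : Measurable β)
    (hy : Measurable y) (hv : Measurable v) (hx : Measurable x) :
    Measurable fun u => linProc i γ β (y u) (v u) (x u) := by
  simp only [linProc, dotProduct, Pi.star_apply, Pi.sub_apply, Finset.sum_apply, Pi.smul_apply,
    smul_eq_mul]
  fun_prop

/-- `E[|g - f X_i|² | v]` for the linear receiver. -/
noncomputable def condMeanMetric (v : 𝒱) : ℝ≥0∞ :=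
  ∫⁻ z, ‖linProc i γ β z.2 v (fun j => z.1 j) - f v * z.1 i‖ₑ ^ 2 ∂C.condLaw v

/-- The contribution of the CSI `v` to `-Λ_i(-t)` for the linear receiver. -/
noncomputable def condExponent (t : ℝ) (v : 𝒱) : ℝ≥0∞ :=
  ∫⁻ z, ENNReal.ofReal (metricExponent t (C.P i) (linProc i γ β z.2 v (fun j => z.1 j)) (f v))
    ∂C.condLaw v

variable {i γ β f}

theorem measurable_condMeanMetric (hγ : ∀ j, Measurable (γ j)) (hβ : Measurable β)
    (hf : Measurable f) : Measurable (C.condMeanMetric i γ β f) := by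
  refine Measurable.lintegral_kernel_prod_right' (κ := C.condLaw) (f := fun p =>
    ‖linProc i γ β p.2.2 p.1 (fun j => p.2.1 j) - f p.1 * p.2.1 i‖ₑ ^ 2) ?_
  have := measurable_linProc i hγ hβ (y := fun p : 𝒱 × ((Fin nt → ℂ) × (Fin nr → ℂ)) => p.2.2)
    (v := Prod.fst) (x := fun p j => p.2.1 j) (by fun_prop) (by fun_prop) (by fun_prop)
  fun_prop

theorem meanMetric_eq (hγ : ∀ j, Measurable (γ j)) (hβ : Measurable β) (hf : Measurable f) :
    C.meanMetric i (linProc i γ β) (csiScale i f) =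
      ∫⁻ v, C.condMeanMetric i γ β f v ∂C.csiLaw := by
  have := measurable_linProc i hγ hβ (y := fun p : 𝒱 × ((Fin nt → ℂ) × (Fin nr → ℂ)) => p.2.2)
    (v := Prod.fst) (x := fun p j => p.2.1 j) (by fun_prop) (by fun_prop) (by fun_prop)
  exact C.lintegral_law (F := fun v z =>
    ‖linProc i γ β z.2 v (fun j => z.1 j) - f v * z.1 i‖ₑ ^ 2)
    (by unfold Function.uncurry; fun_prop)

theorem measurable_linProc_use (hγ : ∀ j, Measurable (γ j)) (hβ : Measurable β) :
    Measurable fun u : Use nt nr 𝒱 => linProc i γ β u.Y u.V (u.Xprev i) :=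
  measurable_linProc i hγ hβ (by fun_prop) (by fun_prop) (by unfold Use.Xprev; fun_prop)

theorem measurable_csiScale_use (hf : Measurable f) :
    Measurable fun u : Use nt nr 𝒱 => csiScale i f u.Y u.V (u.Xprev i) :=
  hf.comp Use.measurable_V

theorem linGMI_eq (hγ : ∀ j, Measurable (γ j)) (hβ : Measurable β) (hf : Measurable f) :
    C.linGMI i γ β f = ⨆ (t : ℝ) (_ : 0 < t),
      (-((ENNReal.ofReal t * ∫⁻ v, C.condMeanMetric i γ β f v ∂C.csiLaw : ℝ≥0∞) : EReal)
        + ((∫⁻ v, C.condExponent i γ β f t v ∂C.csiLaw : ℝ≥0∞) : EReal)) := by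
  have hz := measurable_linProc i hγ hβ
    (y := fun p : 𝒱 × ((Fin nt → ℂ) × (Fin nr → ℂ)) => p.2.2)
    (v := Prod.fst) (x := fun p j => p.2.1 j) (by fun_prop) (by fun_prop) (by fun_prop)
  rw [linGMI, C.gmi_eq (measurable_linProc_use hγ hβ) (measurable_csiScale_use hf),
    C.meanMetric_eq hγ hβ hf]
  have hexp : ∀ t : ℝ, ∫⁻ u, ENNReal.ofReal (metricExponent t (C.P i)
      (linProc i γ β u.Y u.V (u.Xprev i)) (csiScale i f u.Y u.V (u.Xprev i))) ∂C.law =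
      ∫⁻ v, C.condExponent i γ β f t v ∂C.csiLaw := fun t =>
    C.lintegral_law (F := fun v z => ENNReal.ofReal (metricExponent t (C.P i)
      (linProc i γ β z.2 v (fun j => z.1 j)) (f v)))
      (hz.metricExponent (hf.comp measurable_fst)).ennreal_ofReal
  simp_rw [hexp]

end Model
-- Linear estimation and the decoding exponent in an inner product space
section Hilbert

variable {E : Type*} [NormedAddCommGroup E] [InnerProductSpace ℂ E]

local notation "⟪" a ", " b "⟫" => inner ℂ a b

section Projection

variable {nt nr : ℕ}

/-- The residual of the vectors `y` after cancelling the first `i` of the vectors `x`. -/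
def residual (x : Fin nt → E) (y : Fin nr → E) (i : Fin nt) (γ : Fin nt → Fin nr → ℂ)
    (k : Fin nr) : E :=
  y k - ∑ j : {j : Fin nt // j < i}, γ j k • x j

/-- A linear combination of the residuals. -/
def linearEstimate (x : Fin nt → E) (y : Fin nr → E) (i : Fin nt) (γ : Fin nt → Fin nr → ℂ)
    (β : Fin nr → ℂ) : E :=
  ∑ k, star (β k) • residual x y i γ k

variable {x : Fin nt → E} {y : Fin nr → E} {i : Fin nt} {P : Fin nt → ℝ}

/-- The cancelled inputs are orthogonal to `x i`, so γ drops out. -/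
theorem inner_input_linearEstimate (hx : ∀ i j, ⟪x i, x j⟫ = if i = j then (P i : ℂ) else 0)
    (γ : Fin nt → Fin nr → ℂ) (β : Fin nr → ℂ) :
    ⟪x i, linearEstimate x y i γ β⟫ = star β ⬝ᵥ fun k => ⟪x i, y k⟫ := by
  simp only [linearEstimate, residual, inner_sum, inner_smul_right, inner_sub_right, hx,
    dotProduct, Pi.star_apply]
  refine Finset.sum_congr rfl fun k _ => ?_
  rw [Finset.sum_eq_zero, sub_zero]
  intro j _
  rw [if_neg j.2.ne', mul_zero]

theorem inner_residual_input (hx : ∀ i j, ⟪x i, x j⟫ = if i = j then (P i : ℂ) else 0)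
    (hP : ∀ i, 0 < P i) {γ : Fin nt → Fin nr → ℂ}
    (hγ : ∀ j k, γ j k = (P j : ℂ)⁻¹ * ⟪x j, y k⟫) (k : Fin nr) {j : Fin nt} (hj : j < i) :
    ⟪residual x y i γ k, x j⟫ = 0 := by
  have hPj : (P j : ℂ) ≠ 0 := by exact_mod_cast (hP j).ne'
  simp only [residual, inner_sub_left, sum_inner, inner_smul_left, hx]
  rw [Finset.sum_eq_single (⟨j, hj⟩ : {j : Fin nt // j < i})]
  · simp only [if_pos, hγ, map_mul, map_inv₀, Complex.conj_ofReal, inner_conj_symm]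
    field_simp
    ring
  · intro l _ hl
    rw [if_neg fun h => hl (Subtype.ext h), mul_zero]
  · simp

/-- Residuals formed with the optimal γ are orthogonal to every cancelled input, and another γ'
alters the second argument only by such inputs. Hence γ' drops out and the Gram matrix of the
optimal residuals remains. -/
theorem inner_linearEstimate (hx : ∀ i j, ⟪x i, x j⟫ = if i = j then (P i : ℂ) else 0)
    (hP : ∀ i, 0 < P i) {γ : Fin nt → Fin nr → ℂ}
    (hγ : ∀ j k, γ j k = (P j : ℂ)⁻¹ * ⟪x j, y k⟫) (γ' : Fin nt → Fin nr → ℂ)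
    (b β : Fin nr → ℂ) :
    ⟪linearEstimate x y i γ b, linearEstimate x y i γ' β⟫ =
      star β ⬝ᵥ (Matrix.of fun k l => ⟪residual x y i γ l, residual x y i γ k⟫) *ᵥ b := by
  have hres : ∀ (δ : Fin nt → Fin nr → ℂ) k l,
      ⟪residual x y i γ l, residual x y i δ k⟫ = ⟪residual x y i γ l, y k⟫ := by
    intro δ k l
    rw [residual.eq_1 x y i δ, inner_sub_right, inner_sum, Finset.sum_eq_zero, sub_zero]
    intro j _
    rw [inner_smul_right, inner_residual_input hx hP hγ l j.2, mul_zero]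
  simp only [linearEstimate, inner_sum, sum_inner, inner_smul_left, inner_smul_right, hres,
    dotProduct, mulVec, Matrix.of_apply, Pi.star_apply, Finset.mul_sum]
  refine Finset.sum_congr rfl fun k _ => Finset.sum_congr rfl fun l _ => ?_
  simp only [RCLike.star_def, starRingEnd_self_apply]
  ring

end Projection

/-- If `u` has the same inner product as `x` with `w` and with `u` itself, the decoding exponent of
`w` and the scaling `f` is bounded in terms of `‖u‖` only. -/
theorem exponent_le_of_inner_eq {w u x : E} {P t : ℝ} (hP : ‖x‖ ^ 2 = P) (ht : 0 < t)
    (hw : ⟪u, w⟫ = ⟪x, w⟫) (hu : ‖u‖ ^ 2 < P) (f : ℂ) :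
    t * ‖w‖ ^ 2 / (1 + t * P * ‖f‖ ^ 2) + Real.log (1 + t * P * ‖f‖ ^ 2) ≤
      t * ‖w - f • x‖ ^ 2 + Real.log (P / (P - ‖u‖ ^ 2)) := by
  have hP0 : 0 < P := (sq_nonneg _).trans_lt hu
  have hq : 0 < P - ‖u‖ ^ 2 := sub_pos.2 hu
  have hre : RCLike.re ⟪w, f • x⟫ ≤ ‖f‖ * (‖u‖ * ‖w‖) := by
    refine (RCLike.re_le_norm _).trans ?_
    rw [inner_smul_right, norm_mul, ← norm_inner_symm, ← hw]
    gcongr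
    exact norm_inner_le_norm _ _
  have hM : ‖w‖ ^ 2 - 2 * (‖f‖ * (‖u‖ * ‖w‖)) + ‖f‖ ^ 2 * P ≤ ‖w - f • x‖ ^ 2 := by
    rw [norm_sub_sq (𝕜 := ℂ), norm_smul, mul_pow, hP]
    linarith
  generalize ‖w - f • x‖ ^ 2 = M at hM
  generalize ‖w‖ = a at *
  generalize ‖u‖ = b at *
  generalize ‖f‖ = F at *
  set W := 1 + t * P * F ^ 2 with hW
  have hW0 : 0 < W := by positivity
  have hlog : Real.log W - Real.log (P / (P - b ^ 2)) ≤ W * (P - b ^ 2) / P - 1 := by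
    rw [← Real.log_div hW0.ne' (by positivity), div_div_eq_mul_div]
    exact Real.log_le_sub_one_of_pos (by positivity)
  -- After Cauchy–Schwarz (`hM`) and log s ≤ s - 1 with s = W(P - b²)/P (`hlog`), the remaining gap
  -- is exactly this square. The optimal receiver has s = 1 and makes the square vanish.
  have hsq : 0 ≤ (t * F * a * P - b * W) ^ 2 / (P * W) := by positivity
  have hid : (t * F * a * P - b * W) ^ 2 / (P * W) =
      t * (a ^ 2 - 2 * (F * (b * a)) + F ^ 2 * P) - t * a ^ 2 / W - (W * (P - b ^ 2) / P - 1) := by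
    field_simp
    rw [hW]
    ring
  have := mul_le_mul_of_nonneg_left hM ht.le
  linarith

theorem norm_sq_sub_smul_of_inner_eq {u x : E} {P : ℝ} (hP : ‖x‖ ^ 2 = P)
    (hu : ⟪u, u⟫ = ⟪x, u⟫) (a b : ℝ) :
    ‖(a : ℂ) • u - (b : ℂ) • x‖ ^ 2 = a ^ 2 * ‖u‖ ^ 2 - 2 * (a * b * ‖u‖ ^ 2) + b ^ 2 * P := by
  have h : RCLike.re ⟪u, x⟫ = ‖u‖ ^ 2 := by
    rw [← inner_re_symm, ← hu, inner_self_eq_norm_sq]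
  rw [norm_sub_sq (𝕜 := ℂ), inner_smul_left, inner_smul_right, norm_smul, norm_smul, mul_pow,
    mul_pow, hP]
  have h' : RCLike.re ((starRingEnd ℂ) (a : ℂ) * ((b : ℂ) * ⟪u, x⟫)) = a * b * ‖u‖ ^ 2 := by
    rw [Complex.conj_ofReal, ← mul_assoc, ← Complex.ofReal_mul, ← h]
    exact Complex.re_ofReal_mul _ _
  rw [h']
  simp

end Hilbert

/-! ### Random variables as vectors of L² -/

section L2

variable {Ω : Type*} [MeasurableSpace Ω] {μ : Measure Ω}

theorem inner_toLp {F G : Ω → ℂ} (hF : MemLp F 2 μ) (hG : MemLp G 2 μ) :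
    inner ℂ (hF.toLp F) (hG.toLp G) = ∫ z, star (F z) * G z ∂μ := by
  rw [L2.inner_def]
  refine integral_congr_ae ?_
  filter_upwards [hF.coeFn_toLp, hG.coeFn_toLp] with z h1 h2
  rw [h1, h2, RCLike.inner_apply, mul_comm]
  rfl

theorem lintegral_enorm_sq_eq_toLp {F : Ω → ℂ} (hF : MemLp F 2 μ) :
    ∫⁻ z, ‖F z‖ₑ ^ 2 ∂μ = ENNReal.ofReal (‖hF.toLp F‖ ^ 2) := by
  rw [ENNReal.ofReal_pow (norm_nonneg _), ofReal_norm, Lp.enorm_toLp,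
    eLpNorm_eq_lintegral_rpow_enorm_toReal two_ne_zero ENNReal.ofNat_ne_top]
  simp only [ENNReal.toReal_ofNat, ENNReal.rpow_ofNat, one_div]
  rw [← ENNReal.rpow_natCast, ← ENNReal.rpow_mul]
  simp

/-- The membership proof is bundled with the equation because `toLp` depends on it. -/
theorem exists_toLp_sum {ι : Type*} (s : Finset ι) (c : ι → ℂ) {F : ι → Ω → ℂ}
    (hF : ∀ k, MemLp (F k) 2 μ) :
    ∃ h : MemLp (fun z => ∑ k ∈ s, c k * F k z) 2 μ,
      h.toLp _ = ∑ k ∈ s, c k • (hF k).toLp (F k) := by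
  classical
  induction s using Finset.induction_on with
  | empty =>
    refine ⟨by simp, ?_⟩
    simp only [Finset.sum_empty]
    exact MemLp.toLp_zero _
  | insert k s hk ih =>
    obtain ⟨h, hs⟩ := ih
    have hadd : (fun z => ∑ l ∈ insert k s, c l * F l z) =
        (c k • F k) + fun z => ∑ l ∈ s, c l * F l z := by
      ext z
      simp [Finset.sum_insert hk]
    refine ⟨hadd ▸ ((hF k).const_smul (c k)).add h, ?_⟩
    rw [Finset.sum_insert hk, ← hs, ← MemLp.toLp_const_smul, ← MemLp.toLp_add]
    simp only [hadd]

/-- For constant f the exponent is affine in |F|², so only the L² norm of F matters. -/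
theorem lintegral_metricExponent [IsProbabilityMeasure μ] {F : Ω → ℂ} (hF : MemLp F 2 μ)
    {t p : ℝ} (ht : 0 ≤ t) (hp : 0 ≤ p) (f : ℂ) :
    ∫⁻ z, ENNReal.ofReal (metricExponent t p (F z) f) ∂μ =
      ENNReal.ofReal (t * ‖hF.toLp F‖ ^ 2 / (1 + t * p * ‖f‖ ^ 2) +
        Real.log (1 + t * p * ‖f‖ ^ 2)) := by
  have hs : 0 ≤ t * p * ‖f‖ ^ 2 := by positivity
  have hW : 0 < 1 + t * p * ‖f‖ ^ 2 := by positivity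
  have hlog : 0 ≤ Real.log (1 + t * p * ‖f‖ ^ 2) := Real.log_nonneg (by linarith)
  have h : ∀ z, ENNReal.ofReal (metricExponent t p (F z) f) =
      ENNReal.ofReal (t / (1 + t * p * ‖f‖ ^ 2)) * ‖F z‖ₑ ^ 2 +
        ENNReal.ofReal (Real.log (1 + t * p * ‖f‖ ^ 2)) := by
    intro z
    rw [metricExponent, ENNReal.ofReal_add (by positivity) hlog, mul_div_right_comm,
      ENNReal.ofReal_mul (by positivity), ENNReal.ofReal_pow (norm_nonneg _), ofReal_norm]
  simp_rw [h]
  rw [lintegral_add_right _ measurable_const, lintegral_const_mul' _ _ ENNReal.ofReal_ne_top,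
    lintegral_enorm_sq_eq_toLp hF, lintegral_const, measure_univ, mul_one,
    ← ENNReal.ofReal_mul (by positivity), ← ENNReal.ofReal_add (by positivity) hlog,
    mul_div_right_comm]

end L2
-- Optimal receivers for a fixed value of the CSI
namespace Model

variable {nt nr : ℕ} {𝒱 : Type*} [MeasurableSpace 𝒱] (C : Model nt nr 𝒱) {v : 𝒱}

theorem memLp_input (hX : (C.condLaw v).map Prod.fst = Measure.pi fun i => complexGaussian (C.P i))
    (i : Fin nt) : MemLp (fun z : (Fin nt → ℂ) × (Fin nr → ℂ) => z.1 i) 2 (C.condLaw v) :=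
  (memLp_apply_pi_complexGaussian C.P i).comp_measurePreserving ⟨measurable_fst, hX⟩

theorem integral_star_mul_input
    (hX : (C.condLaw v).map Prod.fst = Measure.pi fun i => complexGaussian (C.P i))
    (i j : Fin nt) :
    ∫ z, star (z.1 i) * z.1 j ∂C.condLaw v = if i = j then (C.P i : ℂ) else 0 := by
  rw [← integral_star_mul_pi_complexGaussian C.P (fun i => (C.P_pos i).le), ← hX,
    integral_map measurable_fst.aemeasurable]
  exact Measurable.aestronglyMeasurable (by fun_prop)

/-- Given the CSI, linear receivers are described by vectors `w` in an inner product space, in which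
the optimal estimate `u` is the projection of the input `x` to the space of linear estimates. -/
theorem exists_projection
    (hX : (C.condLaw v).map Prod.fst = Measure.pi fun i => complexGaussian (C.P i))
    (hY : ∀ k : Fin nr,
      MemLp (fun z : (Fin nt → ℂ) × (Fin nr → ℂ) => z.2 k) 2 (C.condLaw v))
    {i : Fin nt} (hinv : IsUnit (C.residualCov i v)) :
    ∃ x u : Lp ℂ 2 (C.condLaw v), ‖x‖ ^ 2 = C.P i ∧ ‖u‖ ^ 2 = C.quadForm i v ∧
      inner ℂ u u = inner ℂ x u ∧
      ∀ (γ : Fin nt → 𝒱 → Fin nr → ℂ) (β : 𝒱 → Fin nr → ℂ), ∃ w : Lp ℂ 2 (C.condLaw v),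
        inner ℂ u w = inner ℂ x w ∧
        (∀ f : 𝒱 → ℂ, C.condMeanMetric i γ β f v = ENNReal.ofReal (‖w - f v • x‖ ^ 2)) ∧
        (∀ (f : 𝒱 → ℂ) (t : ℝ), 0 ≤ t → C.condExponent i γ β f t v =
          ENNReal.ofReal (t * ‖w‖ ^ 2 / (1 + t * C.P i * ‖f v‖ ^ 2) +
            Real.log (1 + t * C.P i * ‖f v‖ ^ 2))) ∧
        ∀ a : ℝ, (∀ j, γ j v = C.optγ j v) → β v = (a : ℂ) • C.βTilde i v → w = (a : ℂ) • u := by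
  have hmx := C.memLp_input hX
  set x : Fin nt → Lp ℂ 2 (C.condLaw v) := fun j => (hmx j).toLp _ with hx
  set y : Fin nr → Lp ℂ 2 (C.condLaw v) := fun k => (hY k).toLp _ with hy
  have hxx : ∀ i j, inner ℂ (x i) (x j) = if i = j then (C.P i : ℂ) else 0 := fun i j => by
    rw [inner_toLp, C.integral_star_mul_input hX]
  have hcross : ∀ i, C.crossMean i v = fun k => inner ℂ (x i) (y k) := fun i => by
    ext k
    rw [inner_toLp, crossMean]
  have hγ : ∀ j k, C.optγ j v k = (C.P j : ℂ)⁻¹ * inner ℂ (x j) (y k) := fun j k => by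
    rw [optγ, hcross]
    rfl
  have hres : ∀ (γ : Fin nt → Fin nr → ℂ) (k : Fin nr),
      ∃ h : MemLp (fun z : (Fin nt → ℂ) × (Fin nr → ℂ) =>
        (z.2 - ∑ j : {j : Fin nt // j < i}, z.1 j • γ j) k) 2 (C.condLaw v),
        h.toLp _ = residual x y i γ k := by
    intro γ k
    obtain ⟨h, hs⟩ := exists_toLp_sum Finset.univ
      (fun j : {j : Fin nt // j < i} => γ j k) fun j => hmx j
    have heq : (fun z : (Fin nt → ℂ) × (Fin nr → ℂ) =>
        (z.2 - ∑ j : {j : Fin nt // j < i}, z.1 j • γ j) k) =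
        (fun z => z.2 k) - fun z => ∑ j : {j : Fin nt // j < i}, γ j k * z.1 j := by
      ext z
      simp [Finset.sum_apply, mul_comm]
    simp only [heq]
    exact ⟨(hY k).sub h, by rw [MemLp.toLp_sub (hY k) h, hs]; rfl⟩
  have hlin : ∀ (γ : Fin nt → 𝒱 → Fin nr → ℂ) (β : 𝒱 → Fin nr → ℂ),
      ∃ h : MemLp (fun z : (Fin nt → ℂ) × (Fin nr → ℂ) =>
        linProc i γ β z.2 v (fun j => z.1 j)) 2 (C.condLaw v),
        h.toLp _ = linearEstimate x y i (fun j => γ j v) (β v) := by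
    intro γ β
    choose h hs using hres fun j => γ j v
    obtain ⟨h', hs'⟩ := exists_toLp_sum Finset.univ (star (β v)) h
    refine ⟨h', ?_⟩
    rw [linearEstimate]
    simp_rw [← hs]
    exact hs'
  -- The indices are swapped because the inner product is conjugate-linear in its first argument.
  have hcov : C.residualCov i v = Matrix.of fun k l => inner ℂ
      (residual x y i (fun j => C.optγ j v) l) (residual x y i (fun j => C.optγ j v) k) := by
    ext k l
    obtain ⟨hk, hk'⟩ := hres (fun j => C.optγ j v) k
    obtain ⟨hl, hl'⟩ := hres (fun j => C.optγ j v) l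
    rw [Matrix.of_apply, ← hk', ← hl', inner_toLp, residualCov, Matrix.of_apply]
    simp_rw [mul_comm]
  -- These are the normal equations for the estimate of the input; invertibility is used only here.
  have hβ : C.residualCov i v *ᵥ C.βTilde i v = C.crossMean i v := by
    rw [βTilde, mulVec_mulVec, mul_nonsing_inv _ ((isUnit_iff_isUnit_det _).1 hinv), one_mulVec]
  set u := linearEstimate x y i (fun j => C.optγ j v) (C.βTilde i v) with hu
  have hproj : ∀ (γ : Fin nt → Fin nr → ℂ) (β : Fin nr → ℂ),
      inner ℂ u (linearEstimate x y i γ β) = inner ℂ (x i) (linearEstimate x y i γ β) := by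
    intro γ β
    rw [hu, inner_linearEstimate hxx C.P_pos hγ, ← hcov, hβ, inner_input_linearEstimate hxx,
      hcross]
  refine ⟨x i, u, ?_, ?_, hproj _ _, fun γ β => ?_⟩
  · rw [← inner_self_eq_norm_sq (𝕜 := ℂ), hxx, if_pos rfl]
    rfl
  · have h1 : star (C.crossMean i v) ⬝ᵥ C.βTilde i v = inner ℂ u u := by
      rw [← inner_conj_symm, hproj, inner_input_linearEstimate hxx, ← hcross,
        ← Complex.star_def, ← star_dotProduct_star, star_star]
    rw [quadForm, ← βTilde, h1, ← inner_self_eq_norm_sq (𝕜 := ℂ)]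
    rfl
  · obtain ⟨h, hw⟩ := hlin γ β
    refine ⟨_, hproj (fun j => γ j v) (β v), fun f => ?_, fun f t ht => ?_, fun a hγa ha => ?_⟩
    · rw [← hw]
      refine (lintegral_enorm_sq_eq_toLp (h.sub ((hmx i).const_smul (f v)))).trans ?_
      rw [MemLp.toLp_sub h ((hmx i).const_smul (f v)), MemLp.toLp_const_smul]
    · rw [← hw, condExponent, lintegral_metricExponent h ht (C.P_pos i).le]
    · simp only [hu, linearEstimate, ha, funext hγa, Finset.smul_sum, smul_smul, Pi.smul_apply,
        smul_eq_mul, star_mul', Complex.star_def, Complex.conj_ofReal]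

/-- The integrand of `linRate`. -/
noncomputable def condRate (i : Fin nt) (v : 𝒱) : ℝ≥0∞ :=
  (ENNReal.log (ENNReal.ofReal (C.P i) / ENNReal.ofReal (C.P i - C.quadForm i v))).toENNReal

theorem condRate_of_lt {i : Fin nt} (h : C.quadForm i v < C.P i) :
    C.condRate i v = ENNReal.ofReal (Real.log (C.P i / (C.P i - C.quadForm i v))) := by
  have hpos := sub_pos.2 h
  rw [condRate, ← ENNReal.ofReal_div_of_pos hpos,
    ENNReal.log_ofReal_of_pos (div_pos (C.P_pos i) hpos), EReal.real_coe_toENNReal]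

theorem condRate_of_ge {i : Fin nt} (h : C.P i ≤ C.quadForm i v) : C.condRate i v = ⊤ := by
  have : ENNReal.ofReal (C.P i) ≠ 0 := by simpa using C.P_pos i
  rw [condRate, ENNReal.ofReal_of_nonpos (sub_nonpos.2 h), ENNReal.div_zero this]
  rfl

/-- The scaling of the estimate `β̃` in receivers that approach the optimum: the optimal one, or `K`
where the input can be estimated without error. -/
noncomputable def approxβ (K : ℝ) (i : Fin nt) (v : 𝒱) : Fin nr → ℂ :=
  ((if C.quadForm i v < C.P i then √(C.Q i v) else K : ℝ) : ℂ) • C.βTilde i v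

/-- The scaling function that belongs to `approxβ`. -/
noncomputable def approxf (K : ℝ) (i : Fin nt) (v : 𝒱) : ℂ :=
  ((if C.quadForm i v < C.P i then √(C.Q i v) * C.fTilde i v else K : ℝ) : ℂ)

/-- The rate that `approxβ` and `approxf` achieve given the CSI. -/
noncomputable def approxRate (K : ℝ) (i : Fin nt) (v : 𝒱) : ℝ≥0∞ :=
  if C.quadForm i v < C.P i then C.condRate i v
  else ENNReal.ofReal (Real.log (1 + C.P i * C.P i * K ^ 2))

/-- The additive form avoids differences of infinite quantities and makes the case q ≥ P_i trivial,
the rate being `⊤` there. -/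
theorem condExponent_le
    (hX : (C.condLaw v).map Prod.fst = Measure.pi fun i => complexGaussian (C.P i))
    (hY : ∀ k : Fin nr,
      MemLp (fun z : (Fin nt → ℂ) × (Fin nr → ℂ) => z.2 k) 2 (C.condLaw v))
    {i : Fin nt} (hinv : IsUnit (C.residualCov i v)) (γ : Fin nt → 𝒱 → Fin nr → ℂ)
    (β : 𝒱 → Fin nr → ℂ) (f : 𝒱 → ℂ) {t : ℝ} (ht : 0 < t) :
    C.condExponent i γ β f t v ≤
      ENNReal.ofReal t * C.condMeanMetric i γ β f v + C.condRate i v := by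
  by_cases hq : C.quadForm i v < C.P i
  · obtain ⟨x, u, hx, hu, -, h⟩ := C.exists_projection hX hY hinv
    obtain ⟨w, hw, hM, hR, -⟩ := h γ β
    rw [hM, hR f t ht.le, C.condRate_of_lt hq, ← hu, ← ENNReal.ofReal_mul ht.le]
    exact (ENNReal.ofReal_le_ofReal (exponent_le_of_inner_eq hx ht hw (hu ▸ hq) (f v))).trans
      ENNReal.ofReal_add_le
  · rw [C.condRate_of_ge (not_lt.1 hq), add_top]
    exact le_top

/-- The uniform bound on the conditional metric makes its mean finite, and the second bound is at t
= P_i for all v, as the GMI has a single t for the whole average. -/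
theorem approxReceiver_bounds
    (hX : (C.condLaw v).map Prod.fst = Measure.pi fun i => complexGaussian (C.P i))
    (hY : ∀ k : Fin nr,
      MemLp (fun z : (Fin nt → ℂ) × (Fin nr → ℂ) => z.2 k) 2 (C.condLaw v))
    {i : Fin nt} (hinv : IsUnit (C.residualCov i v)) (K : ℝ) :
    C.condMeanMetric i C.optγ (C.approxβ K i) (C.approxf K i) v ≤ ENNReal.ofReal (1 / C.P i) ∧
    ENNReal.ofReal (C.P i) * C.condMeanMetric i C.optγ (C.approxβ K i) (C.approxf K i) v +
      C.approxRate K i v ≤ C.condExponent i C.optγ (C.approxβ K i) (C.approxf K i) (C.P i) v := by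
  obtain ⟨x, u, hx, hu, hux, h⟩ := C.exists_projection hX hY hinv
  obtain ⟨w, -, hM, hR, hw⟩ := h C.optγ (C.approxβ K i)
  have hw := hw _ (fun _ => rfl) rfl
  have hP := C.P_pos i
  have hM' := hM (C.approxf K i)
  rw [hw, approxf, norm_sq_sub_smul_of_inner_eq hx hux, hu] at hM'
  have hR' := hR (C.approxf K i) (C.P i) hP.le
  rw [hw, approxf, norm_smul, mul_pow, hu, Complex.norm_real, Complex.norm_real,
    Real.norm_eq_abs, Real.norm_eq_abs, sq_abs, sq_abs] at hR'
  rw [hM', hR', ← ENNReal.ofReal_mul hP.le]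
  have hq0 : 0 ≤ C.quadForm i v := hu ▸ sq_nonneg _
  -- This is ‖u - x‖² = P_i - q ≥ 0.
  have hqle : C.quadForm i v ≤ C.P i := by
    have := norm_sq_sub_smul_of_inner_eq hx hux 1 1
    rw [hu] at this
    nlinarith [sq_nonneg ‖((1 : ℝ) : ℂ) • u - ((1 : ℝ) : ℂ) • x‖]
  by_cases hq : C.quadForm i v < C.P i
  · simp only [approxRate, if_pos hq]
    rw [C.condRate_of_lt hq]
    -- If q = 0, division by zero gives `Q = 0`; the receiver and its rate then vanish.
    obtain hq0 | hq0 := hq0.eq_or_lt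
    · simp [Q, fTilde, ← hq0, hP.ne']
    set q := C.quadForm i v
    have hqP : 0 < C.P i - q := sub_pos.2 hq
    have hρ : C.fTilde i v = q / C.P i := rfl
    have hQ : C.Q i v = 1 / (q * (C.P i - q)) := by
      rw [Q, hρ]
      congr 1
      field_simp
    have hQ2 : √(C.Q i v) ^ 2 = 1 / (q * (C.P i - q)) := by
      rw [Real.sq_sqrt (by rw [hQ]; positivity), hQ]
    have hmean : √(C.Q i v) ^ 2 * q - 2 * (√(C.Q i v) * (√(C.Q i v) * C.fTilde i v) * q) +
        (√(C.Q i v) * C.fTilde i v) ^ 2 * C.P i = 1 / C.P i := by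
      have : √(C.Q i v) ^ 2 * q - 2 * (√(C.Q i v) * (√(C.Q i v) * C.fTilde i v) * q) +
        (√(C.Q i v) * C.fTilde i v) ^ 2 * C.P i = √(C.Q i v) ^ 2 *
          (q - 2 * C.fTilde i v * q + C.fTilde i v ^ 2 * C.P i) := by ring
      rw [this, hQ2, hρ]
      field_simp
      ring
    have hW : 1 + C.P i * C.P i * (√(C.Q i v) * C.fTilde i v) ^ 2 = C.P i / (C.P i - q) := by
      rw [mul_pow, hQ2, hρ]
      field_simp
      ring
    have hlog : 0 ≤ Real.log (C.P i / (C.P i - q)) :=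
      Real.log_nonneg ((one_le_div hqP).2 (by linarith))
    rw [hmean, hW, hQ2]
    refine ⟨le_rfl, ?_⟩
    rw [← ENNReal.ofReal_add (by positivity) hlog]
    refine le_of_eq (congrArg ENNReal.ofReal (congrArg (· + _) ?_))
    field_simp
  -- Now ‖u - x‖² = 0: the metric vanishes for every K, and the logarithm alone gives the rate.
  · have hqe : C.quadForm i v = C.P i := le_antisymm hqle (not_lt.1 hq)
    simp only [approxRate, if_neg hq]
    rw [hqe]
    have h0 : K ^ 2 * C.P i - 2 * (K * K * C.P i) + K ^ 2 * C.P i = 0 := by ring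
    rw [h0, mul_zero, ENNReal.ofReal_zero, zero_add]
    refine ⟨zero_le, ENNReal.ofReal_le_ofReal (le_add_of_nonneg_left (by positivity))⟩

theorem measurable_approxβ (K : ℝ) (i : Fin nt) : Measurable (C.approxβ K i) := by
  have := C.measurable_βTilde i
  have h : Measurable fun v => (if C.quadForm i v < C.P i then √(C.Q i v) else K) :=
    Measurable.ite (measurableSet_lt (C.measurable_quadForm i) measurable_const)
      (C.measurable_Q i).sqrt measurable_const
  unfold approxβ
  fun_prop

theorem measurable_approxf (K : ℝ) (i : Fin nt) : Measurable (C.approxf K i) :=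
  Complex.measurable_ofReal.comp <|
    Measurable.ite (measurableSet_lt (C.measurable_quadForm i) measurable_const)
      ((C.measurable_Q i).sqrt.mul (C.measurable_fTilde i)) measurable_const

theorem measurable_condRate (i : Fin nt) : Measurable (C.condRate i) := by
  have := C.measurable_quadForm i
  unfold condRate
  fun_prop

theorem measurable_approxRate (K : ℝ) (i : Fin nt) : Measurable (C.approxRate K i) :=
  Measurable.ite (measurableSet_lt (C.measurable_quadForm i) measurable_const)
    (C.measurable_condRate i) measurable_const

/-- Monotone convergence: where q ≥ P_i, the rates increase with K to ∞. -/
theorem tendsto_lintegral_approxRate (i : Fin nt) :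
    Tendsto (fun K : ℕ => ∫⁻ v, C.approxRate K i v ∂C.csiLaw) atTop (𝓝 (C.linRate i)) := by
  have hP := C.P_pos i
  refine lintegral_tendsto_of_tendsto_of_monotone (F := C.condRate i)
    (fun K => (C.measurable_approxRate K i).aemeasurable) (ae_of_all _ fun v K L hKL => ?_)
    (ae_of_all _ fun v => ?_)
  · simp only [approxRate]
    split_ifs
    · exact le_rfl
    · gcongr
  · by_cases hq : C.quadForm i v < C.P i
    · simp only [approxRate, if_pos hq]
      exact tendsto_const_nhds
    · simp only [approxRate, if_neg hq, C.condRate_of_ge (not_lt.1 hq)]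
      refine ENNReal.tendsto_ofReal_nhds_top.2 (Real.tendsto_log_atTop.comp ?_)
      exact tendsto_atTop_add_const_left _ _ (Tendsto.const_mul_atTop (by positivity)
        ((tendsto_pow_atTop two_ne_zero).comp tendsto_natCast_atTop_atTop))

end Model
-- Averaging over the CSI
namespace Model

variable {nt nr : ℕ} {𝒱 : Type*} [MeasurableSpace 𝒱] (C : Model nt nr 𝒱) {i : Fin nt}

theorem linGMI_le_linRate
    (hY : ∀ᵐ v ∂C.csiLaw, ∀ k : Fin nr,
      MemLp (fun z : (Fin nt → ℂ) × (Fin nr → ℂ) => z.2 k) 2 (C.condLaw v))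
    (hinv : ∀ᵐ v ∂C.csiLaw, IsUnit (C.residualCov i v))
    {γ : Fin nt → 𝒱 → Fin nr → ℂ} {β : 𝒱 → Fin nr → ℂ} {f : 𝒱 → ℂ}
    (hγ : ∀ j, Measurable (γ j)) (hβ : Measurable β) (hf : Measurable f) :
    C.linGMI i γ β f ≤ (C.linRate i : EReal) := by
  rw [C.linGMI_eq hγ hβ hf]
  refine iSup₂_le fun t ht => ?_
  rw [add_comm, ← sub_eq_add_neg]
  refine EReal.sub_le_of_le_add' ?_
  rw [← EReal.coe_ennreal_add, EReal.coe_ennreal_le_coe_ennreal_iff,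
    ← lintegral_const_mul' _ _ ENNReal.ofReal_ne_top]
  refine LE.le.trans ?_
    (lintegral_add_left ((C.measurable_condMeanMetric hγ hβ hf).const_mul _) (C.condRate i)).le
  refine lintegral_mono_ae ?_
  filter_upwards [C.condLaw_map_fst, hY, hinv] with v h1 h2 h3
  exact C.condExponent_le h1 h2 h3 γ β f ht

/-- Finiteness of the mean metric is what allows it to be subtracted in `EReal`. -/
theorem lintegral_le_linGMI {γ : Fin nt → 𝒱 → Fin nr → ℂ} {β : 𝒱 → Fin nr → ℂ} {f : 𝒱 → ℂ}
    (hγ : ∀ j, Measurable (γ j)) (hβ : Measurable β) (hf : Measurable f) {t : ℝ} (ht : 0 < t)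
    (hfin : ∫⁻ v, C.condMeanMetric i γ β f v ∂C.csiLaw ≠ ⊤) {r : 𝒱 → ℝ≥0∞}
    (hr : ∀ᵐ v ∂C.csiLaw, ENNReal.ofReal t * C.condMeanMetric i γ β f v + r v ≤
      C.condExponent i γ β f t v) :
    ((∫⁻ v, r v ∂C.csiLaw : ℝ≥0∞) : EReal) ≤ C.linGMI i γ β f := by
  rw [C.linGMI_eq hγ hβ hf]
  refine le_iSup₂_of_le t ht ?_
  have hne : ENNReal.ofReal t * ∫⁻ v, C.condMeanMetric i γ β f v ∂C.csiLaw ≠ ⊤ :=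
    ENNReal.mul_ne_top ENNReal.ofReal_ne_top hfin
  rw [add_comm, ← sub_eq_add_neg, EReal.le_sub_iff_add_le (.inl (EReal.coe_ennreal_ne_bot _))
    (.inl (EReal.coe_ennreal_eq_top_iff.not.2 hne)), ← EReal.coe_ennreal_add,
    EReal.coe_ennreal_le_coe_ennreal_iff, add_comm,
    ← lintegral_const_mul' _ _ ENNReal.ofReal_ne_top,
    ← lintegral_add_left ((C.measurable_condMeanMetric hγ hβ hf).const_mul _)]
  exact lintegral_mono_ae hr

theorem lintegral_approxRate_le_linGMI
    (hY : ∀ᵐ v ∂C.csiLaw, ∀ k : Fin nr,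
      MemLp (fun z : (Fin nt → ℂ) × (Fin nr → ℂ) => z.2 k) 2 (C.condLaw v))
    (hinv : ∀ᵐ v ∂C.csiLaw, IsUnit (C.residualCov i v)) (K : ℝ) :
    ((∫⁻ v, C.approxRate K i v ∂C.csiLaw : ℝ≥0∞) : EReal) ≤
      C.linGMI i C.optγ (C.approxβ K i) (C.approxf K i) := by
  have hb : ∀ᵐ v ∂C.csiLaw,
      C.condMeanMetric i C.optγ (C.approxβ K i) (C.approxf K i) v ≤ ENNReal.ofReal (1 / C.P i) ∧
      ENNReal.ofReal (C.P i) * C.condMeanMetric i C.optγ (C.approxβ K i) (C.approxf K i) v +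
        C.approxRate K i v ≤
      C.condExponent i C.optγ (C.approxβ K i) (C.approxf K i) (C.P i) v := by
    filter_upwards [C.condLaw_map_fst, hY, hinv] with v h1 h2 h3
    exact C.approxReceiver_bounds h1 h2 h3 K
  refine C.lintegral_le_linGMI C.measurable_optγ (C.measurable_approxβ K i)
    (C.measurable_approxf K i) (C.P_pos i) ?_ (hb.mono fun v hv => hv.2)
  refine ne_top_of_le_ne_top (ENNReal.ofReal_ne_top (r := 1 / C.P i)) ?_
  refine (lintegral_mono_ae (hb.mono fun v hv => hv.1)).trans ?_
  simp

theorem linGMI_congr {γ : Fin nt → 𝒱 → Fin nr → ℂ} {β β' : 𝒱 → Fin nr → ℂ} {f f' : 𝒱 → ℂ}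
    (hγ : ∀ j, Measurable (γ j)) (hβ : Measurable β) (hf : Measurable f)
    (hβ' : Measurable β') (hf' : Measurable f')
    (h : ∀ᵐ v ∂C.csiLaw, β v = β' v ∧ f v = f' v) :
    C.linGMI i γ β f = C.linGMI i γ β' f' := by
  have hM : ∫⁻ v, C.condMeanMetric i γ β f v ∂C.csiLaw =
      ∫⁻ v, C.condMeanMetric i γ β' f' v ∂C.csiLaw :=
    lintegral_congr_ae (h.mono fun v hv => by simp only [condMeanMetric, linProc, hv.1, hv.2])
  have hR : ∀ t, ∫⁻ v, C.condExponent i γ β f t v ∂C.csiLaw =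
      ∫⁻ v, C.condExponent i γ β' f' t v ∂C.csiLaw := fun t =>
    lintegral_congr_ae (h.mono fun v hv => by simp only [condExponent, linProc, hv.1, hv.2])
  rw [C.linGMI_eq hγ hβ hf, C.linGMI_eq hγ hβ' hf', hM]
  simp_rw [hR]

theorem linGMI_opt
    (hY : ∀ᵐ v ∂C.csiLaw, ∀ k : Fin nr,
      MemLp (fun z : (Fin nt → ℂ) × (Fin nr → ℂ) => z.2 k) 2 (C.condLaw v))
    (hinv : ∀ᵐ v ∂C.csiLaw, IsUnit (C.residualCov i v))
    (hq : ∀ᵐ v ∂C.csiLaw, C.quadForm i v < C.P i) :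
    C.linGMI i C.optγ (C.optβ i) (C.optf i) = (C.linRate i : EReal) := by
  refine le_antisymm (C.linGMI_le_linRate hY hinv C.measurable_optγ (C.measurable_optβ i)
    (C.measurable_optf i)) ?_
  -- The branch that involves K is a null event here, so K = 0 serves as well as any other value.
  have hrate : C.linRate i = ∫⁻ v, C.approxRate 0 i v ∂C.csiLaw :=
    lintegral_congr_ae (hq.mono fun v hv => (if_pos hv).symm)
  rw [hrate, C.linGMI_congr C.measurable_optγ (C.measurable_optβ i) (C.measurable_optf i)
    (C.measurable_approxβ 0 i) (C.measurable_approxf 0 i)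
    (hq.mono fun v hv => ⟨by simp only [optβ, approxβ, if_pos hv],
      by simp only [optf, approxf, if_pos hv]⟩)]
  exact C.lintegral_approxRate_le_linGMI hY hinv 0

theorem tendsto_coe_lintegral_approxRate (i : Fin nt) :
    Tendsto (fun K : ℕ => ((∫⁻ v, C.approxRate K i v ∂C.csiLaw : ℝ≥0∞) : EReal)) atTop
      (𝓝 (C.linRate i : EReal)) :=
  (continuous_coe_ennreal_ereal.tendsto _).comp (C.tendsto_lintegral_approxRate i)

theorem tendsto_sum_coe_lintegral_approxRate :
    Tendsto (fun K : ℕ => ∑ i, ((∫⁻ v, C.approxRate K i v ∂C.csiLaw : ℝ≥0∞) : EReal)) atTop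
      (𝓝 (∑ i, (C.linRate i : EReal))) := by
  -- Addition on `EReal` is not continuous everywhere, so the limit of the sum is taken in `ℝ≥0∞`.
  have hcoe : ∀ r : Fin nt → ℝ≥0∞, ∑ i, (r i : EReal) = ((∑ i, r i : ℝ≥0∞) : EReal) := fun r =>
    (map_sum (⟨⟨((↑) : ℝ≥0∞ → EReal), EReal.coe_ennreal_zero⟩, EReal.coe_ennreal_add⟩ :
      ℝ≥0∞ →+ EReal) r Finset.univ).symm
  simp_rw [hcoe]
  exact (continuous_coe_ennreal_ereal.tendsto _).comp
    (tendsto_finsetSum _ fun i _ => C.tendsto_lintegral_approxRate i)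

end Model
end SGNNDR

theorem theorem2 {nt nr : ℕ} {𝒱 : Type*} [MeasurableSpace 𝒱] (C : SGNNDR.Model nt nr 𝒱)
    -- given the CSI, the output has finite second moments
    (hY : ∀ᵐ v ∂C.csiLaw, ∀ k : Fin nr,
      MemLp (fun z : (Fin nt → ℂ) × (Fin nr → ℂ) => z.2 k) 2 (C.condLaw v))
    -- the conditional covariance matrices are invertible
    (hinv : ∀ i : Fin nt, ∀ᵐ v ∂C.csiLaw, IsUnit (C.residualCov i v)) :
    -- the limits in the definition of the GMI exist almost surely
    (∀ (i : Fin nt) (γ : Fin nt → 𝒱 → Fin nr → ℂ) (β : 𝒱 → Fin nr → ℂ) (f : 𝒱 → ℂ),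
      (∀ j, Measurable (γ j)) → Measurable β → Measurable f → ∀ θ : ℝ, θ < 0 →
      ∀ᵐ s ∂C.blockLaw, Tendsto
        (fun N : ℕ => C.blockLogMGF i (SGNNDR.Model.linProc i γ β) (SGNNDR.Model.csiScale i f)
          θ N s / (N : EReal)) atTop
        (𝓝 (C.limitLogMGF i (SGNNDR.Model.linProc i γ β) (SGNNDR.Model.csiScale i f) θ))) ∧
    -- the optimized GMI of each substream
    (∀ i : Fin nt, IsLUB
      {I : EReal | ∃ (γ : Fin nt → 𝒱 → Fin nr → ℂ) (β : 𝒱 → Fin nr → ℂ) (f : 𝒱 → ℂ),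
        (∀ j, Measurable (γ j)) ∧ Measurable β ∧ Measurable f ∧ I = C.linGMI i γ β f}
      (C.linRate i : EReal)) ∧
    -- the explicit receiver is admissible, and it achieves the optimum when `Q_i` is well defined
    (∀ i : Fin nt, Measurable (C.optγ i) ∧ Measurable (C.optβ i) ∧ Measurable (C.optf i) ∧
      ((∀ᵐ v ∂C.csiLaw, C.quadForm i v < C.P i) →
        C.linGMI i C.optγ (C.optβ i) (C.optf i) = (C.linRate i : EReal))) ∧
    -- the optimized sum GMI, over receivers that use the same `γ` for all substreams
    IsLUB
      {I : EReal | ∃ (γ β : Fin nt → 𝒱 → Fin nr → ℂ) (f : Fin nt → 𝒱 → ℂ),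
        (∀ j, Measurable (γ j)) ∧ (∀ j, Measurable (β j)) ∧ (∀ j, Measurable (f j)) ∧
        I = ∑ i, C.linGMI i γ (β i) (f i)}
      (∑ i, (C.linRate i : EReal)) := by
  refine ⟨fun i γ β f hγ hβ hf θ hθ => ?_, fun i => ⟨?_, ?_⟩, fun i =>
    ⟨C.measurable_optγ i, C.measurable_optβ i, C.measurable_optf i,
      C.linGMI_opt hY (hinv i)⟩, ?_, ?_⟩
  · have hg := SGNNDR.Model.measurable_linProc_use (i := i) hγ hβ
    have hf' := SGNNDR.Model.measurable_csiScale_use (nr := nr) (i := i) hf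
    rw [C.limitLogMGF_eq hθ.le hg hf']
    exact C.tendsto_blockLogMGF hθ.le hg hf'
  · rintro _ ⟨γ, β, f, hγ, hβ, hf, rfl⟩
    exact C.linGMI_le_linRate hY (hinv i) hγ hβ hf
  · intro B hB
    -- Attainment is not claimed where q = P_i may occur; the supremum is approached as K → ∞.
    refine le_of_tendsto' (C.tendsto_coe_lintegral_approxRate i) fun K => ?_
    exact (C.lintegral_approxRate_le_linGMI hY (hinv i) K).trans
      (hB ⟨_, _, _, C.measurable_optγ, C.measurable_approxβ K i, C.measurable_approxf K i, rfl⟩)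
  · rintro _ ⟨γ, β, f, hγ, hβ, hf, rfl⟩
    exact Finset.sum_le_sum fun i _ => C.linGMI_le_linRate hY (hinv i) hγ (hβ i) (hf i)
  · intro B hB
    refine le_of_tendsto' C.tendsto_sum_coe_lintegral_approxRate fun K => ?_
    -- The witness γ = `C.optγ` depends neither on the substream nor on K, as a common γ requires.
    exact (Finset.sum_le_sum fun i _ => C.lintegral_approxRate_le_linGMI hY (hinv i) K).trans
      (hB ⟨_, _, _, C.measurable_optγ, C.measurable_approxβ K, C.measurable_approxf K, rfl⟩)
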